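/- Let $p$ be a prime, $n\ge 1$, and let $\psi(x)=e^{2\pi i\lambda(x)}$ be the standard additive character of $\mathbb{Q}_p$, where $\lambda(x)$ is any rational number of the form $m/p^k$ with $\lambda(x)-x\in\mathbb{Z}_p$. Put $\|x\|=\max_i|x_i|$ on $\mathbb{Q}_p^n$ and $K=GL_n(\mathbb{Z}_p)$. Let $dx$ be the Haar measure on $\mathbb{Q}_p^n$ with $\mathbb{Z}_p^n$ of measure $1$, and $d^\times g$ the Haar measure on $GL_n(\mathbb{Q}_p)$ with $K$ of measure $1$. A second degree character of a locally compact abelian group $G$ is a continuous map $f:G\to\mathbb{T}$ such that $f(x+y)f(x)^{-1}f(y)^{-1}$ is a character of $G$ in each of the variables $x$ and $y$; its associated morphism $\varrho:G\to G^*$ is given by $\langle\varrho(y),x\rangle=f(x+y)f(x)^{-1}f(y)^{-1}$, and $f$ is non-degenerate if $\varrho$ is an isomorphism of topological groups. We identify $\mathbb{Q}_p^n$ with its dual by letting $u$ correspond to $x\mapsto\psi(\sum_i x_iu_i)$. Let $\mathcal{H}$ be the Hecke algebra of locally constant, compactly supported, bi-$K$-invariant functions $\phi:GL_n(\mathbb{Q}_p)\to\mathbb{C}$.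 For $\phi\in\mathcal{H}$ put $(\lambda(\phi)F)(v)=\int_{GL_n(\mathbb{Q}_p)}\phi(g)F(g^{-1}v)\,d^\times g$ and $\phi^*(g)=|\det g|^{-1}\phi(g^{-1})$, and let $\xi_t(\phi)$ be the scalar with $\lambda(\phi)\|x\|^t=\xi_t(\phi)\|x\|^t$ for all $x\ne0$. Let $M(F,s)=\int_{\mathbb{Q}_p^n}F(x)\|x\|^{s-n}\,dx$. A number $M$ is the (radial) weak Mellin transform of $f$ at $s$ if, for every $\phi\in\mathcal{H}$, the integral $M(\lambda(\phi)f,s)$ converges absolutely and equals $\xi_{s-n}(\phi^*)\,M$. Theorem. Let $f$ be a non-degenerate second degree character on $\mathbb{Q}_p^n$ whose associated morphism is a dilation $\varrho=\alpha\,\mathrm{Id}$ with $\alpha\in\mathbb{Q}_p$. Then the weak Mellin transform $\zeta_f(s)$ of $f$ exists and is unique for every $s$ with $\operatorname{Re}(s)>0$, and all its zeros there lie on the line $\operatorname{Re}(s)=n/2$. Moreover $\zeta_f$ is analytic on $\operatorname{Re}(s)>0$ and extends to a meromorphic function on $\mathbb{C}$, all of whose zeros lie on the line $\operatorname{Re}(s)=n/2$.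 -/

import Mathlib

open scoped Matrix MatrixGroups

noncomputable section

namespace WeakMellin

/-! ### The standard additive character of `ℚ_p` -/

section StandardCharacter

variable (p : ℕ) [Fact p.Prime]

/-- `r` is a rational number of the form `m / p ^ k` with `r - x ∈ ℤ_p`. -/
def IsFractionalPart (x : ℚ_[p]) (r : ℚ) : Prop :=
  (∃ (m : ℤ) (k : ℕ), r = m / (p : ℚ) ^ k) ∧ ‖(r : ℚ_[p]) - x‖ ≤ 1

theorem exists_isFractionalPart (x : ℚ_[p]) : ∃ r : ℚ, IsFractionalPart p x r := by
  have hp : 1 < (p : ℝ) := by exact_mod_cast (Fact.out : p.Prime).one_lt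
  have hp0 : (0 : ℝ) < p := by linarith
  have hpp : (p : ℚ_[p]) ≠ 0 := by exact_mod_cast (Fact.out : p.Prime).ne_zero
  obtain ⟨k, hk⟩ := pow_unbounded_of_one_lt ‖x‖ hp
  have hy : ‖(p : ℚ_[p]) ^ k * x‖ ≤ 1 := by
    rw [norm_mul, norm_pow, Padic.norm_p, inv_pow]
    rw [inv_mul_le_iff₀ (by positivity)]
    linarith
  have hpos : (0 : ℝ) < ((p : ℝ) ^ k)⁻¹ := by positivity
  obtain ⟨y, hyx⟩ : ∃ y : ℤ_[p], (y : ℚ_[p]) = (p : ℚ_[p]) ^ k * x := ⟨⟨_, hy⟩, rfl⟩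
  obtain ⟨m, hm⟩ := PadicInt.denseRange_intCast.exists_dist_lt y hpos
  refine ⟨m / (p : ℚ) ^ k, ⟨m, k, rfl⟩, ?_⟩
  have hm' : ‖(p : ℚ_[p]) ^ k * x - m‖ < ((p : ℝ) ^ k)⁻¹ := by
    rw [dist_eq_norm, PadicInt.norm_def] at hm
    simpa [hyx] using hm
  have hmul : (((m / (p : ℚ) ^ k : ℚ) : ℚ_[p]) - x)
      = -(((p : ℚ_[p]) ^ k)⁻¹ * ((p : ℚ_[p]) ^ k * x - m)) := by
    push_cast
    field_simp
    ring
  rw [hmul, norm_neg, norm_mul, norm_inv, norm_pow, Padic.norm_p, inv_pow, inv_inv]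
  calc (p : ℝ) ^ k * ‖(p : ℚ_[p]) ^ k * x - m‖ ≤ (p : ℝ) ^ k * ((p : ℝ) ^ k)⁻¹ := by gcongr
    _ = 1 := mul_inv_cancel₀ (by positivity)

/-- A chosen rational number `λ(x) = m / p ^ k` with `λ(x) - x ∈ ℤ_p`. -/
def fractionalPart (x : ℚ_[p]) : ℚ := (exists_isFractionalPart p x).choose

/-- The standard additive character `ψ(x) = exp (2 π i λ(x))` of `ℚ_p`. -/
def stdChar (x : ℚ_[p]) : Circle := Circle.exp (2 * Real.pi * (fractionalPart p x : ℝ))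

/-- `ψ(x)` does not depend on the choice of `λ(x)`. -/
theorem stdChar_eq (x : ℚ_[p]) (r : ℚ) (hr : IsFractionalPart p x r) :
    stdChar p x = Circle.exp (2 * Real.pi * (r : ℝ)) := by
  have hp : p.Prime := Fact.out
  have hs : IsFractionalPart p x (fractionalPart p x) := (exists_isFractionalPart p x).choose_spec
  set s := fractionalPart p x with hsdef
  obtain ⟨⟨m, k, hmk⟩, hr1⟩ := hr
  obtain ⟨⟨m', k', hmk'⟩, hs1⟩ := hs
  have hnorm : ‖((s - r : ℚ) : ℚ_[p])‖ ≤ 1 := by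
    have h : ((s - r : ℚ) : ℚ_[p]) = ((s : ℚ_[p]) - x) - ((r : ℚ_[p]) - x) := by push_cast; ring
    rw [h]
    rw [sub_eq_add_neg]
    exact (Padic.nonarchimedean _ _).trans (max_le hs1 (by rwa [norm_neg]))
  have hq : s - r = ((m' * p ^ k - m * p ^ k' : ℤ) : ℚ) / ((p ^ (k + k') : ℕ) : ℤ) := by
    have hp0 : (p : ℚ) ≠ 0 := by exact_mod_cast hp.ne_zero
    rw [hmk, hmk']
    push_cast
    rw [pow_add]
    field_simp
  have hden : (s - r).den ∣ p ^ (k + k') := by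
    have := Rat.den_dvd (m' * p ^ k - m * p ^ k' : ℤ) ((p ^ (k + k') : ℕ) : ℤ)
    rw [Rat.divInt_eq_div, ← hq] at this
    exact_mod_cast this
  have hint : ∃ z : ℤ, s - r = z := by
    obtain ⟨j, -, hj⟩ := (Nat.dvd_prime_pow hp).1 hden
    rcases Nat.eq_zero_or_pos j with rfl | hjpos
    · exact ⟨(s - r).num, ((Rat.den_eq_one_iff _).1 (by simpa using hj)).symm⟩
    · exfalso
      have hdvd : p ∣ (s - r).den := hj ▸ dvd_pow_self p hjpos.ne'
      have hnum : ¬ (p : ℤ) ∣ (s - r).num := by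
        intro h
        have h1 : p ∣ (s - r).num.natAbs := Int.natCast_dvd.1 h
        exact hp.one_lt.ne' (Nat.dvd_one.1 ((s - r).reduced ▸ Nat.dvd_gcd h1 hdvd))
      have hnn : ‖(((s - r).num : ℤ) : ℚ_[p])‖ = 1 :=
        le_antisymm (Padic.norm_int_le_one _)
          (not_lt.1 fun h => hnum ((Padic.norm_intCast_lt_one_iff).1 h))
      have hdn : ‖(((s - r).den : ℕ) : ℚ_[p])‖ < 1 := (Padic.norm_natCast_lt_one_iff).2 hdvd
      have hd0 : (0 : ℝ) < ‖(((s - r).den : ℕ) : ℚ_[p])‖ :=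
        norm_pos_iff.2 (by exact_mod_cast (s - r).den_nz)
      have heq : ((s - r : ℚ) : ℚ_[p]) = ((s - r).num : ℚ_[p]) / ((s - r).den : ℚ_[p]) := by
        exact_mod_cast congrArg (fun q : ℚ => (q : ℚ_[p])) (Rat.num_div_den (s - r)).symm
      rw [heq, norm_div, hnn, div_le_one hd0] at hnorm
      linarith
  obtain ⟨z, hz⟩ := hint
  have hsr : (s : ℝ) = r + z := by
    have : s = r + z := by linarith
    exact_mod_cast congrArg (fun q : ℚ => (q : ℝ)) this
  rw [stdChar, ← hsdef, hsr, Circle.exp_eq_exp]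
  exact ⟨z, by ring⟩

end StandardCharacter

/-! ### Second degree characters -/

section SecondDegree

/-- A continuous function `f : G → 𝕋` such that `(x, y) ↦ f (x + y) f(x)⁻¹ f(y)⁻¹` is a
bicharacter. -/
structure SecondDegreeCharacter (G : Type*) [AddCommGroup G] [TopologicalSpace G] where
  toFun : G → Circle
  continuous_toFun : Continuous toFun
  bichar_add_left : ∀ x x' y : G,
    toFun (x + x' + y) * (toFun (x + x'))⁻¹ * (toFun y)⁻¹ =
      (toFun (x + y) * (toFun x)⁻¹ * (toFun y)⁻¹) *
        (toFun (x' + y) * (toFun x')⁻¹ * (toFun y)⁻¹)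
  bichar_add_right : ∀ x y y' : G,
    toFun (x + (y + y')) * (toFun x)⁻¹ * (toFun (y + y'))⁻¹ =
      (toFun (x + y) * (toFun x)⁻¹ * (toFun y)⁻¹) *
        (toFun (x + y') * (toFun x)⁻¹ * (toFun y')⁻¹)

namespace SecondDegreeCharacter

variable {G : Type*} [AddCommGroup G] [TopologicalSpace G] [IsTopologicalAddGroup G]

/-- The character `⟨ϱ(y), ·⟩ : x ↦ f (x + y) f(x)⁻¹ f(y)⁻¹` of `G`. -/
def assocChar (f : SecondDegreeCharacter G) (y : G) : PontryaginDual (Multiplicative G) :=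
  ContinuousMonoidHom.mk
    (MonoidHom.mk' (fun x : Multiplicative G =>
        f.toFun (x.toAdd + y) * (f.toFun x.toAdd)⁻¹ * (f.toFun y)⁻¹)
      (fun x x' => f.bichar_add_left x.toAdd x'.toAdd y))
    (by
      have h := f.continuous_toFun
      have h1 : Continuous fun x : G => f.toFun (x + y) * (f.toFun x)⁻¹ * (f.toFun y)⁻¹ := by
        fun_prop
      exact h1.comp continuous_toAdd)

theorem assocChar_apply (f : SecondDegreeCharacter G) (x y : G) :
    f.assocChar y (Multiplicative.ofAdd x) = f.toFun (x + y) * (f.toFun x)⁻¹ * (f.toFun y)⁻¹ :=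
  rfl

/-- The morphism `ϱ : G → G^*` associated to `f` (written multiplicatively). -/
def assocHom (f : SecondDegreeCharacter G) :
    Multiplicative G →* PontryaginDual (Multiplicative G) :=
  MonoidHom.mk' (fun y => f.assocChar y.toAdd) (fun y y' => by
    refine ContinuousMonoidHom.ext fun x => ?_
    exact f.bichar_add_right x.toAdd y.toAdd y'.toAdd)

/-- `f` is non-degenerate: `ϱ` is an isomorphism of topological groups from `G` to `G^*`. -/
def IsNondegenerate (f : SecondDegreeCharacter G) : Prop := IsHomeomorph f.assocHom

end SecondDegreeCharacter

/-- The morphism associated to `f` is the dilation `α Id`, where `ℚ_p^n` is identified with its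
dual by letting `u` correspond to the character `x ↦ ψ(x · u)`. -/
def IsDilation {p : ℕ} [Fact p.Prime] {n : ℕ} (f : SecondDegreeCharacter (Fin n → ℚ_[p]))
    (α : ℚ_[p]) : Prop :=
  ∀ x y : Fin n → ℚ_[p],
    f.assocHom (Multiplicative.ofAdd y) (Multiplicative.ofAdd x) = stdChar p (x ⬝ᵥ (α • y))

end SecondDegree

/-! ### Haar measures -/

section Haar

variable (p : ℕ) [Fact p.Prime] (n : ℕ)

instance instMeasurableSpacePadic : MeasurableSpace ℚ_[p] := borel _

instance instBorelSpacePadic : BorelSpace ℚ_[p] := ⟨rfl⟩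

/-- The compact open subset `ℤ_p` of `ℚ_p`. -/
def unitBall : TopologicalSpace.PositiveCompacts ℚ_[p] where
  carrier := Metric.closedBall 0 1
  isCompact' := isCompact_closedBall 0 1
  interior_nonempty' :=
    ⟨0, Metric.ball_subset_interior_closedBall (Metric.mem_ball_self one_pos)⟩

/-- The Haar measure `dx` on `ℚ_p^n`, the product of the Haar measures on `ℚ_p` that give `ℤ_p`
measure `1`. -/
def vecHaar : MeasureTheory.Measure (Fin n → ℚ_[p]) :=
  MeasureTheory.Measure.pi fun _ => MeasureTheory.Measure.addHaarMeasure (unitBall p)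

/-- The subgroup `K = GL_n(ℤ_p)` of `GL_n(ℚ_p)`. -/
def maxCompact : Subgroup (GL (Fin n) ℚ_[p]) :=
  (Matrix.GeneralLinearGroup.map (n := Fin n) (algebraMap ℤ_[p] ℚ_[p])).range

instance instMeasurableSpaceGL : MeasurableSpace (GL (Fin n) ℚ_[p]) := borel _

instance instBorelSpaceGL : BorelSpace (GL (Fin n) ℚ_[p]) := ⟨rfl⟩

theorem mem_maxCompact_iff (g : GL (Fin n) ℚ_[p]) :
    g ∈ maxCompact p n ↔ (∀ i j, ‖(g : Matrix (Fin n) (Fin n) ℚ_[p]) i j‖ ≤ 1) ∧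
      ∀ i j, ‖(↑g⁻¹ : Matrix (Fin n) (Fin n) ℚ_[p]) i j‖ ≤ 1 := by
  constructor
  · rintro ⟨h, rfl⟩
    refine ⟨fun i j => (h.1 i j).2, fun i j => ?_⟩
    rw [← map_inv]
    exact ((h⁻¹).1 i j).2
  · rintro ⟨h1, h2⟩
    let A : Matrix (Fin n) (Fin n) ℤ_[p] := fun i j => ⟨g.1 i j, h1 i j⟩
    let B : Matrix (Fin n) (Fin n) ℤ_[p] := fun i j => ⟨(g⁻¹).1 i j, h2 i j⟩
    have hinj : Function.Injective
        (fun M : Matrix (Fin n) (Fin n) ℤ_[p] => M.map (algebraMap ℤ_[p] ℚ_[p])) :=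
      Matrix.map_injective (f := algebraMap ℤ_[p] ℚ_[p]) Subtype.val_injective
    have hA : A.map (algebraMap ℤ_[p] ℚ_[p]) = g.1 := rfl
    have hB : B.map (algebraMap ℤ_[p] ℚ_[p]) = (g⁻¹).1 := rfl
    have hAB : A * B = 1 := hinj (by
      simp only [Matrix.map_mul, hA, hB, ← Units.val_mul]
      simp only [mul_inv_cancel, Units.val_one]
      exact (Matrix.map_one _ (map_zero _) (map_one _)).symm)
    have hBA : B * A = 1 := hinj (by
      simp only [Matrix.map_mul, hA, hB, ← Units.val_mul]
      simp only [inv_mul_cancel, Units.val_one]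
      exact (Matrix.map_one _ (map_zero _) (map_one _)).symm)
    exact ⟨⟨A, B, hAB, hBA⟩, Units.ext hA⟩

theorem isOpen_maxCompact : IsOpen (maxCompact p n : Set (GL (Fin n) ℚ_[p])) := by
  have hball : IsOpen {x : ℚ_[p] | ‖x‖ ≤ 1} := by
    have := IsUltrametricDist.isOpen_closedBall (0 : ℚ_[p]) one_ne_zero
    simpa [Metric.closedBall, dist_zero_right] using this
  have hs : (maxCompact p n : Set (GL (Fin n) ℚ_[p])) =
      (⋂ i, ⋂ j, {g : GL (Fin n) ℚ_[p] | ‖(g : Matrix (Fin n) (Fin n) ℚ_[p]) i j‖ ≤ 1}) ∩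
      ⋂ i, ⋂ j, {g : GL (Fin n) ℚ_[p] | ‖(↑g⁻¹ : Matrix (Fin n) (Fin n) ℚ_[p]) i j‖ ≤ 1} := by
    ext g
    simp [mem_maxCompact_iff]
  rw [hs]
  refine (isOpen_iInter_of_finite fun i => isOpen_iInter_of_finite fun j => ?_).inter
    (isOpen_iInter_of_finite fun i => isOpen_iInter_of_finite fun j => ?_)
  · exact hball.preimage (Units.continuous_val.matrix_elem i j)
  · exact hball.preimage ((Units.continuous_val.comp continuous_inv).matrix_elem i j)

theorem isCompact_maxCompact : IsCompact (maxCompact p n : Set (GL (Fin n) ℚ_[p])) := by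
  have : CompactSpace (Matrix (Fin n) (Fin n) ℤ_[p]) :=
    inferInstanceAs (CompactSpace (Fin n → Fin n → ℤ_[p]))
  have hc : Continuous (Matrix.GeneralLinearGroup.map (n := Fin n) (algebraMap ℤ_[p] ℚ_[p])) := by
    refine Continuous.units_map _ ?_
    exact continuous_id.matrix_map continuous_subtype_val
  have := isCompact_range hc
  simpa [maxCompact, MonoidHom.coe_range] using this

/-- `K = GL_n(ℤ_p)` as a compact set with non-empty interior. -/
def maxCompactPC : TopologicalSpace.PositiveCompacts (GL (Fin n) ℚ_[p]) where
  carrier := maxCompact p n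
  isCompact' := isCompact_maxCompact p n
  interior_nonempty' := by
    rw [(isOpen_maxCompact p n).interior_eq]
    exact ⟨1, one_mem _⟩

/-- The Haar measure `d^×g` on `GL_n(ℚ_p)` that gives `K` measure `1`. -/
def glHaar : MeasureTheory.Measure (GL (Fin n) ℚ_[p]) :=
  MeasureTheory.Measure.haarMeasure (maxCompactPC p n)

end Haar

/-! ### The radial weak Mellin transform -/

section Mellin

variable {p : ℕ} [Fact p.Prime] {n : ℕ}

/-- The Hecke algebra `H(GL_n(ℚ_p))`: locally constant functions with compact support that are
invariant under `K` on the left and on the right. -/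
structure IsHecke (φ : GL (Fin n) ℚ_[p] → ℂ) : Prop where
  isLocallyConstant : IsLocallyConstant φ
  hasCompactSupport : HasCompactSupport φ
  biinvariant : ∀ k₁ ∈ maxCompact p n, ∀ k₂ ∈ maxCompact p n, ∀ g, φ (k₁ * g * k₂) = φ g

/-- `(λ(φ) F)(v) = ∫ φ(g) F(g⁻¹ v) d^×g`. -/
def lam (φ : GL (Fin n) ℚ_[p] → ℂ) (F : (Fin n → ℚ_[p]) → ℂ) (v : Fin n → ℚ_[p]) : ℂ :=
  ∫ g, φ g * F ((↑g⁻¹ : Matrix (Fin n) (Fin n) ℚ_[p]) *ᵥ v) ∂(glHaar p n)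

/-- The function `‖x‖ ^ t`, where `‖x‖ = max |x_i|`. -/
def normPow (t : ℂ) (x : Fin n → ℚ_[p]) : ℂ := (‖x‖ : ℂ) ^ t

/-- The Mellin transform of `F` at `s` converges absolutely. -/
def MellinConverges (F : (Fin n → ℚ_[p]) → ℂ) (s : ℂ) : Prop :=
  MeasureTheory.Integrable (fun x => F x * normPow (s - n) x) (vecHaar p n)

/-- The Mellin transform `M(F, s) = ∫ F(x) ‖x‖ ^ (s - n) dx`. -/
def mellinVec (F : (Fin n → ℚ_[p]) → ℂ) (s : ℂ) : ℂ :=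
  ∫ x, F x * normPow (s - n) x ∂(vecHaar p n)

/-- `φ^*(g) = |det g|⁻¹ φ(g⁻¹)`. -/
def adj (φ : GL (Fin n) ℚ_[p] → ℂ) (g : GL (Fin n) ℚ_[p]) : ℂ :=
  ((‖(g : Matrix (Fin n) (Fin n) ℚ_[p]).det‖⁻¹ : ℝ) : ℂ) * φ g⁻¹

/-- `ξ` is the scalar `ξ_t(φ)`: `λ(φ) ‖x‖ ^ t = ξ ‖x‖ ^ t` for all `x ≠ 0`. -/
def IsXi (φ : GL (Fin n) ℚ_[p] → ℂ) (t ξ : ℂ) : Prop :=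
  ∀ x : Fin n → ℚ_[p], x ≠ 0 → lam φ (normPow t) x = ξ * normPow t x

/-- `M` is the (radial) weak Mellin transform of `F` at `s`: for every `φ` in the Hecke algebra,
`M(λ(φ) F, s)` converges absolutely and equals `ξ_{s-n}(φ^*) M`. -/
def IsWeakMellin (F : (Fin n → ℚ_[p]) → ℂ) (s M : ℂ) : Prop :=
  ∀ φ : GL (Fin n) ℚ_[p] → ℂ, IsHecke φ →
    MellinConverges (lam φ F) s ∧
      ∃ ξ : ℂ, IsXi (adj φ) (s - n) ξ ∧ mellinVec (lam φ F) s = ξ * M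

end Mellin

end WeakMellin

end

/-!
Let `B k` be the integral of `f` over the ball of radius `p ^ k`. Since `f (x + y)` is
`f x * f y * ψ (α x · y)`, translation and orthogonality of characters determine these integrals up
to one constant (`IsDilation.exists_integral_pBall`): there are integers `k₀ ≤ k₁` such that `f = 1`
on the ball of radius `p ^ k₀`, `B k = 0` for `k₀ < k < k₁`, and `B k` is a constant `C` for
`k₁ ≤ k`, with `‖C‖ ^ 2 = p ^ ((k₀ + k₁) n)`. The bounds satisfy `p ^ (-k₀ - k₁) = |α|`: they
correspond to each other under the duality of lattices given by the bicharacter of `f`.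

The average `f♮ = lam (kInd p n) f` of `f` over `K` is constant on spheres, because `K` is
transitive on them. Hence it is locally constant and vanishes outside the ball of radius `p ^ k₁`, and its
Mellin transform converges absolutely for `0 < Re s`. A Hecke function is a finite linear
combination of indicator functions of cosets `g K`, so `λ(φ) f` is the corresponding combination of
translates of `f♮`; the change of variables `x ↦ g x`, together with the unimodularity of
`GL_n(ℚ_p)`, moves the operator to `‖x‖ ^ (s - n)` (`mellin_lam`). So the Mellin transform of `f♮`
is the weak Mellin transform of `f`, and the unit of the Hecke algebra shows that it is the only one.
Unimodularity and the Jacobian `|det g|` both follow from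
`char_eq_one_of_trivial_on_maxCompact_of_trivial_on_scalar`.

Summation over spheres gives `ζ(s) = N(s) / (1 - p ^ (-s))`. With `P = p ^ s` and `ρ = p ^ (-n)`,
the entire function `N` has no zeros if `k₀ = k₁`, and otherwise
`N = P ^ k₀ (1 - ρ P) + C (ρ P) ^ k₁ (1 - P⁻¹)`. The zeros of the latter satisfy
`ρ |P| ^ 2 = 1`, that is, `Re s = n / 2`, by the elementary inequality in `mul_norm_sq_eq_one`.
-/

noncomputable section

namespace WeakMellin

open MeasureTheory

/-! ### Balls and spheres in `ℚ_p^n` and their volumes -/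

section Balls

variable (p : ℕ) [Fact p.Prime] (n : ℕ)

/-- The lattice `p^(-k) ℤ_p^n`, that is, the ball of radius `p ^ k` around the origin. -/
def pBall (k : ℤ) : Set (Fin n → ℚ_[p]) := {x | ‖x‖ ≤ (p : ℝ) ^ k}

/-- The sphere of radius `p ^ k` around the origin. -/
def pSphere (k : ℤ) : Set (Fin n → ℚ_[p]) := {x | ‖x‖ = (p : ℝ) ^ k}

theorem one_lt_p : (1 : ℝ) < p := by exact_mod_cast (Fact.out : p.Prime).one_lt

theorem p_pos : (0 : ℝ) < p := zero_lt_one.trans (one_lt_p p)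

variable {p n}

theorem mem_pBall {k : ℤ} {x : Fin n → ℚ_[p]} : x ∈ pBall p n k ↔ ‖x‖ ≤ (p : ℝ) ^ k := Iff.rfl

theorem mem_pSphere {k : ℤ} {x : Fin n → ℚ_[p]} : x ∈ pSphere p n k ↔ ‖x‖ = (p : ℝ) ^ k := Iff.rfl

theorem zpow_p_pos (k : ℤ) : (0 : ℝ) < (p : ℝ) ^ k := zpow_pos (p_pos p) k

theorem zpow_p_le {j k : ℤ} : (p : ℝ) ^ j ≤ (p : ℝ) ^ k ↔ j ≤ k :=
  zpow_le_zpow_iff_right₀ (one_lt_p p)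

theorem zpow_p_lt {j k : ℤ} : (p : ℝ) ^ j < (p : ℝ) ^ k ↔ j < k :=
  zpow_lt_zpow_iff_right₀ (one_lt_p p)

theorem zpow_p_inj {j k : ℤ} : (p : ℝ) ^ j = (p : ℝ) ^ k ↔ j = k :=
  zpow_right_inj₀ (p_pos p) (one_lt_p p).ne'

theorem exists_norm_eq_zpow_padic {x : ℚ_[p]} (hx : x ≠ 0) : ∃ k : ℤ, ‖x‖ = (p : ℝ) ^ k :=
  ⟨_, Padic.norm_eq_zpow_neg_valuation hx⟩

theorem norm_zpow_p (k : ℤ) : ‖(p : ℚ_[p]) ^ k‖ = (p : ℝ) ^ (-k) := by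
  rw [norm_zpow, Padic.norm_p, inv_zpow, zpow_neg]

theorem p_ne_zero : (p : ℚ_[p]) ≠ 0 := by exact_mod_cast (Fact.out : p.Prime).ne_zero

theorem exists_norm_apply_eq (hn : 1 ≤ n) (x : Fin n → ℚ_[p]) : ∃ i, ‖x i‖ = ‖x‖ := by
  have : Nonempty (Fin n) := ⟨⟨0, hn⟩⟩
  obtain ⟨i, -, hi⟩ := Finset.exists_mem_eq_sup' Finset.univ_nonempty (fun i => ‖x i‖)
  refine ⟨i, le_antisymm (norm_le_pi_norm x i) ?_⟩
  refine (pi_norm_le_iff_of_nonneg (norm_nonneg _)).2 fun j => ?_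
  rw [← hi]
  exact Finset.le_sup' (fun i => ‖x i‖) (Finset.mem_univ j)

theorem exists_norm_eq_zpow {x : Fin n → ℚ_[p]} (hx : x ≠ 0) : ∃ k : ℤ, ‖x‖ = (p : ℝ) ^ k := by
  have hn : 1 ≤ n := by
    rcases Nat.eq_zero_or_pos n with rfl | h
    · exact absurd (Subsingleton.elim x 0) hx
    · exact h
  obtain ⟨i, hi⟩ := exists_norm_apply_eq hn x
  rw [← hi]
  refine exists_norm_eq_zpow_padic fun h => hx ?_
  rw [h, norm_zero] at hi
  exact norm_eq_zero.1 hi.symm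

theorem pBall_mono {j k : ℤ} (h : j ≤ k) : pBall p n j ⊆ pBall p n k :=
  fun _ hx => hx.trans (zpow_p_le.2 h)

theorem zero_mem_pBall (k : ℤ) : (0 : Fin n → ℚ_[p]) ∈ pBall p n k := by
  rw [mem_pBall, norm_zero]; exact (zpow_p_pos k).le

theorem add_mem_pBall {k : ℤ} {x y : Fin n → ℚ_[p]} (hx : x ∈ pBall p n k)
    (hy : y ∈ pBall p n k) : x + y ∈ pBall p n k :=
  (IsUltrametricDist.norm_add_le_max x y).trans (max_le hx hy)

theorem neg_mem_pBall {k : ℤ} {x : Fin n → ℚ_[p]} (hx : x ∈ pBall p n k) :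
    -x ∈ pBall p n k := by
  rwa [mem_pBall, norm_neg]

theorem add_mem_pBall_iff {k : ℤ} {x y : Fin n → ℚ_[p]} (hy : y ∈ pBall p n k) :
    x + y ∈ pBall p n k ↔ x ∈ pBall p n k :=
  ⟨fun h => by simpa using add_mem_pBall h (neg_mem_pBall hy), fun h => add_mem_pBall h hy⟩

theorem pBall_eq_closedBall (k : ℤ) : pBall p n k = Metric.closedBall 0 ((p : ℝ) ^ k) := by
  ext x; simp [mem_pBall]

theorem isCompact_pBall (k : ℤ) : IsCompact (pBall p n k) := by
  rw [pBall_eq_closedBall]; exact isCompact_closedBall _ _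

theorem isOpen_pBall (k : ℤ) : IsOpen (pBall p n k) := by
  rw [pBall_eq_closedBall]; exact IsUltrametricDist.isOpen_closedBall _ (zpow_p_pos k).ne'

theorem isClosed_pBall (k : ℤ) : IsClosed (pBall p n k) := (isCompact_pBall k).isClosed

theorem isClopen_pBall (k : ℤ) : IsClopen (pBall p n k) := ⟨isClosed_pBall k, isOpen_pBall k⟩

theorem measurableSet_pBall (k : ℤ) : MeasurableSet (pBall p n k) :=
  (isClosed_pBall k).measurableSet

theorem pBall_sdiff_pBall_sub_one (k : ℤ) : pBall p n k \ pBall p n (k - 1) = pSphere p n k := by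
  ext x
  simp only [Set.mem_sdiff, mem_pBall, mem_pSphere, not_le]
  constructor
  · rintro ⟨h1, h2⟩
    have hx : x ≠ 0 := by
      rintro rfl
      rw [norm_zero] at h2
      exact absurd h2 (zpow_p_pos _).le.not_gt
    obtain ⟨j, hj⟩ := exists_norm_eq_zpow hx
    rw [hj, zpow_p_le] at h1
    rw [hj, zpow_p_lt] at h2
    rw [hj, show j = k by omega]
  · intro h
    rw [h]
    exact ⟨le_rfl, zpow_p_lt.2 (by omega)⟩

theorem pSphere_subset_pBall (k : ℤ) : pSphere p n k ⊆ pBall p n k := fun _ h => le_of_eq h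

theorem isClopen_pSphere (k : ℤ) : IsClopen (pSphere p n k) := by
  rw [← pBall_sdiff_pBall_sub_one]
  exact (isClopen_pBall k).diff (isClopen_pBall (k - 1))

theorem measurableSet_pSphere (k : ℤ) : MeasurableSet (pSphere p n k) :=
  (isClopen_pSphere k).1.measurableSet

theorem pairwise_disjoint_pSphere : Pairwise (Function.onFun Disjoint (pSphere p n)) := by
  intro i j hij
  refine Set.disjoint_left.2 fun x hi hj => hij ?_
  rw [mem_pSphere] at hi hj
  exact zpow_p_inj.1 (hi.symm.trans hj)

instance instIsAddHaarMeasureVecHaar : (vecHaar p n).IsAddHaarMeasure := by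
  unfold vecHaar; infer_instance

instance instSigmaFiniteVecHaar : SigmaFinite (vecHaar p n) := by
  unfold vecHaar; infer_instance

instance instRegularVecHaar : (vecHaar p n).Regular := by
  unfold vecHaar; infer_instance

theorem addHaar_closedBall_eq_mul (k : ℤ) :
    Measure.addHaarMeasure (unitBall p) (Metric.closedBall 0 ((p : ℝ) ^ k)) =
      p * Measure.addHaarMeasure (unitBall p) (Metric.closedBall 0 ((p : ℝ) ^ (k - 1))) := by
  set ν := Measure.addHaarMeasure (unitBall p)
  -- the ball of radius `p ^ k` is the disjoint union of `p` translates of the next smaller one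
  let c : Fin p → ℚ_[p] := fun i => (i : ℕ) * (p : ℚ_[p]) ^ (-k)
  have hcn : ∀ i, ‖c i‖ ≤ (p : ℝ) ^ k := fun i => by
    rw [norm_mul, norm_zpow_p, neg_neg]
    exact mul_le_of_le_one_left (zpow_p_pos k).le (Padic.norm_int_le_one (i : ℤ))
  have hunion : Metric.closedBall (0 : ℚ_[p]) ((p : ℝ) ^ k) =
      ⋃ i : Fin p, Metric.closedBall (c i) ((p : ℝ) ^ (k - 1)) := by
    ext x
    simp only [Set.mem_iUnion, Metric.mem_closedBall, dist_eq_norm, sub_zero]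
    constructor
    · intro hx
      have hz : ‖(p : ℚ_[p]) ^ k * x‖ ≤ 1 := by
        rw [norm_mul, norm_zpow_p, zpow_neg, inv_mul_le_iff₀ (zpow_p_pos k), mul_one]
        exact hx
      obtain ⟨y, hy⟩ : ∃ y : ℤ_[p], (y : ℚ_[p]) = (p : ℚ_[p]) ^ k * x := ⟨⟨_, hz⟩, rfl⟩
      obtain ⟨m, hm, hmem⟩ := PadicInt.exists_mem_range y
      refine ⟨⟨m, hm⟩, ?_⟩
      have h1 : ‖(p : ℚ_[p]) ^ k * x - m‖ ≤ (p : ℝ) ^ (-1 : ℤ) := by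
        have h2 : ‖y - m‖ < 1 := by
          rw [PadicInt.maximalIdeal_eq_span_p, Ideal.mem_span_singleton] at hmem
          exact (PadicInt.norm_lt_one_iff_dvd _).2 hmem
        rw [PadicInt.norm_def] at h2
        have h3 : ‖(p : ℚ_[p]) ^ k * x - m‖ < 1 := by simpa [hy] using h2
        rcases eq_or_ne ((p : ℚ_[p]) ^ k * x - m) 0 with h0 | h0
        · rw [h0, norm_zero]; exact (zpow_p_pos _).le
        · obtain ⟨j, hj⟩ := exists_norm_eq_zpow_padic h0
          rw [hj] at h3 ⊢
          rw [← zpow_zero (p : ℝ), zpow_p_lt] at h3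
          exact zpow_p_le.2 (by omega)
      have h4 : x - c ⟨m, hm⟩ = (p : ℚ_[p]) ^ (-k) * ((p : ℚ_[p]) ^ k * x - m) := by
        rw [mul_sub, ← mul_assoc, ← zpow_add₀ p_ne_zero]
        simp [c, mul_comm]
      rw [h4, norm_mul, norm_zpow_p, neg_neg, sub_eq_add_neg k 1, zpow_add₀ (p_pos p).ne']
      exact mul_le_mul_of_nonneg_left h1 (zpow_p_pos k).le
    · rintro ⟨i, hi⟩
      have : x = (x - c i) + c i := by ring
      rw [this]
      exact (IsUltrametricDist.norm_add_le_max _ _).trans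
        (max_le (hi.trans (zpow_p_le.2 (by omega))) (hcn i))
  have hdisj : Pairwise (Function.onFun Disjoint
      fun i : Fin p => Metric.closedBall (c i) ((p : ℝ) ^ (k - 1))) := by
    intro i j hij
    refine Set.disjoint_left.2 fun x hi hj => hij ?_
    simp only [Metric.mem_closedBall, dist_eq_norm] at hi hj
    have h1 : ‖c i - c j‖ ≤ (p : ℝ) ^ (k - 1) := by
      have : c i - c j = (x - c j) + -(x - c i) := by ring
      rw [this]
      exact (IsUltrametricDist.norm_add_le_max _ _).trans (max_le hj (by rwa [norm_neg]))
    have h2 : c i - c j = (((i : ℕ) - (j : ℕ) : ℤ) : ℚ_[p]) * (p : ℚ_[p]) ^ (-k) := by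
      simp [c, sub_mul]
    rw [h2, norm_mul, norm_zpow_p, neg_neg, sub_eq_add_neg k 1, zpow_add₀ (p_pos p).ne', mul_comm,
      mul_le_mul_iff_right₀ (zpow_p_pos k)] at h1
    have h3 : ‖((((i : ℕ) - (j : ℕ) : ℤ)) : ℚ_[p])‖ < 1 :=
      h1.trans_lt (by rw [← zpow_zero (p : ℝ), zpow_p_lt]; omega)
    rw [Padic.norm_intCast_lt_one_iff] at h3
    have hi2 := i.2
    have hj2 := j.2
    have := Int.eq_zero_of_abs_lt_dvd h3 (by rw [abs_lt]; omega)
    exact Fin.ext (by omega)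
  rw [hunion, measure_iUnion hdisj fun i => Metric.isClosed_closedBall.measurableSet]
  have : ∀ i, ν (Metric.closedBall (c i) ((p : ℝ) ^ (k - 1))) =
      ν (Metric.closedBall 0 ((p : ℝ) ^ (k - 1))) := fun i => by
    rw [← measure_preimage_add ν (c i) (Metric.closedBall (c i) _)]
    congr 1
    ext x
    simp [dist_eq_norm]
  simp [this]

theorem addHaar_closedBall (k : ℤ) :
    Measure.addHaarMeasure (unitBall p) (Metric.closedBall 0 ((p : ℝ) ^ k)) =
      ENNReal.ofReal ((p : ℝ) ^ k) := by
  have hp : (p : ENNReal) = ENNReal.ofReal p := by simp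
  have hp0 : (p : ENNReal) ≠ 0 := by exact_mod_cast (Fact.out : p.Prime).ne_zero
  induction k with
  | zero =>
    rw [zpow_zero, ENNReal.ofReal_one]
    exact Measure.addHaarMeasure_self (K₀ := unitBall p)
  | succ k ih =>
    rw [addHaar_closedBall_eq_mul, add_sub_cancel_right, ih, hp,
      ← ENNReal.ofReal_mul (p_pos p).le, zpow_add_one₀ (p_pos p).ne', mul_comm]
  | pred k ih =>
    have h := addHaar_closedBall_eq_mul (p := p) (-k)
    rw [ih] at h
    have h2 : (p : ENNReal) * ENNReal.ofReal ((p : ℝ) ^ (-k - 1 : ℤ)) =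
        ENNReal.ofReal ((p : ℝ) ^ (-k : ℤ)) := by
      rw [hp, ← ENNReal.ofReal_mul (p_pos p).le, ← zpow_one_add₀ (p_pos p).ne']
      congr 2
      ring
    rw [← h2] at h
    exact ((ENNReal.mul_right_inj hp0 (ENNReal.natCast_ne_top p)).1 h).symm

/-- The ball of radius `p ^ k` in `ℚ_p^n` has volume `p ^ (k n)`. -/
theorem vecHaar_pBall (k : ℤ) :
    vecHaar p n (pBall p n k) = ENNReal.ofReal ((p : ℝ) ^ (k * n)) := by
  have : pBall p n k = Set.univ.pi fun _ => Metric.closedBall 0 ((p : ℝ) ^ k) := by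
    ext x
    simp [mem_pBall, pi_norm_le_iff_of_nonneg (zpow_p_pos (p := p) k).le]
  rw [this, vecHaar, Measure.pi_pi]
  simp only [addHaar_closedBall, Finset.prod_const, Finset.card_univ, Fintype.card_fin]
  rw [← ENNReal.ofReal_pow (zpow_p_pos k).le, zpow_mul, zpow_natCast]

theorem vecHaar_real_pBall (k : ℤ) : (vecHaar p n).real (pBall p n k) = (p : ℝ) ^ (k * n) := by
  rw [measureReal_def, vecHaar_pBall, ENNReal.toReal_ofReal (zpow_p_pos _).le]

theorem vecHaar_singleton_zero (hn : 1 ≤ n) : vecHaar p n {0} = 0 := by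
  refine le_antisymm (ENNReal.le_of_forall_pos_le_add fun ε hε _ => ?_) zero_le
  obtain ⟨k, hk⟩ := exists_pow_lt_of_lt_one (NNReal.coe_pos.2 hε)
    (inv_lt_one_of_one_lt₀ (one_lt_p p))
  rw [zero_add]
  refine (measure_mono (Set.singleton_subset_iff.2 (zero_mem_pBall (-k)))).trans ?_
  rw [vecHaar_pBall, ← ENNReal.ofReal_coe_nnreal]
  refine ENNReal.ofReal_le_ofReal (le_trans ?_ hk.le)
  rw [inv_pow, ← zpow_natCast, ← zpow_neg, zpow_p_le]
  nlinarith [show (1 : ℤ) ≤ n by exact_mod_cast hn]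

end Balls

/-! ### The group `GL_n(ℚ_p)` and its maximal compact subgroup -/

section Group

variable {p : ℕ} [Fact p.Prime] {n : ℕ}

instance instSecondCountableGL : SecondCountableTopology (GL (Fin n) ℚ_[p]) := by
  have : SecondCountableTopology (Matrix (Fin n) (Fin n) ℚ_[p]) :=
    inferInstanceAs (SecondCountableTopology (Fin n → Fin n → ℚ_[p]))
  have : SecondCountableTopology (Matrix (Fin n) (Fin n) ℚ_[p])ᵐᵒᵖ :=
    MulOpposite.opHomeomorph.symm.isEmbedding.secondCountableTopology
  exact (Units.isEmbedding_embedProduct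
    (M := Matrix (Fin n) (Fin n) ℚ_[p])).secondCountableTopology

instance instLocallyCompactGL : LocallyCompactSpace (GL (Fin n) ℚ_[p]) :=
  (maxCompactPC p n).locallyCompactSpace_of_group

theorem mem_maxCompact_of_map (A : Matrix (Fin n) (Fin n) ℤ_[p]) (hA : IsUnit A.det)
    (g : GL (Fin n) ℚ_[p]) (hg : (g : Matrix (Fin n) (Fin n) ℚ_[p]) =
      A.map (algebraMap ℤ_[p] ℚ_[p])) : g ∈ maxCompact p n := by
  obtain ⟨u, hu⟩ := (Matrix.isUnit_iff_isUnit_det A).2 hA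
  refine ⟨u, Units.ext ?_⟩
  rw [hg, ← hu]
  rfl

theorem swap_val (i j : Fin n) : (Matrix.GeneralLinearGroup.swap ℚ_[p] i j :
    Matrix (Fin n) (Fin n) ℚ_[p]) = Matrix.swap ℚ_[p] i j := rfl

theorem swap_mem_maxCompact (i j : Fin n) :
    Matrix.GeneralLinearGroup.swap ℚ_[p] i j ∈ maxCompact p n :=
  ⟨Matrix.GeneralLinearGroup.swap ℤ_[p] i j, Matrix.GeneralLinearGroup.map_swap _ i j⟩

theorem mem_maxCompact_of_eq_transvection {i j : Fin n} (hij : i ≠ j) {c : ℚ_[p]} (hc : ‖c‖ ≤ 1)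
    (g : GL (Fin n) ℚ_[p])
    (hg : (g : Matrix (Fin n) (Fin n) ℚ_[p]) = Matrix.transvection i j c) :
    g ∈ maxCompact p n := by
  obtain ⟨c, rfl⟩ : ∃ c' : ℤ_[p], (c' : ℚ_[p]) = c := ⟨⟨c, hc⟩, rfl⟩
  refine mem_maxCompact_of_map (Matrix.transvection i j c) ?_ g ?_
  · rw [Matrix.det_transvection_of_ne i j hij]
    exact isUnit_one
  · rw [hg]
    ext a b
    simp only [Matrix.transvection, Matrix.add_apply, Matrix.map_apply, map_add, Matrix.one_apply,
      Matrix.single_apply]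
    split_ifs <;> simp

/-- The diagonal embedding of the torus `(ℚ_p^×)^n` into `GL_n(ℚ_p)`. -/
def torus (p : ℕ) [Fact p.Prime] (n : ℕ) : (Fin n → ℚ_[p]ˣ) →* GL (Fin n) ℚ_[p] :=
  (Units.map (Matrix.diagonalRingHom (Fin n) ℚ_[p]).toMonoidHom).comp
    (MulEquiv.piUnits (M := fun _ : Fin n => ℚ_[p])).symm.toMonoidHom

theorem torus_val (d : Fin n → ℚ_[p]ˣ) :
    (torus p n d : Matrix (Fin n) (Fin n) ℚ_[p]) = Matrix.diagonal fun i => (d i : ℚ_[p]) := rfl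

theorem torus_mulSingle_mul_swap (i j : Fin n) (u : ℚ_[p]ˣ) :
    torus p n (Pi.mulSingle i u) * Matrix.GeneralLinearGroup.swap ℚ_[p] i j =
      Matrix.GeneralLinearGroup.swap ℚ_[p] i j * torus p n (Pi.mulSingle j u) := by
  refine Units.ext ?_
  ext a b
  simp only [Units.val_mul, torus_val, Matrix.diagonal_mul, Matrix.mul_diagonal,
    swap_val, Matrix.swap, Equiv.Perm.permMatrix, PEquiv.toMatrix_apply,
    Equiv.toPEquiv_apply, Option.mem_def, Option.some.injEq]
  by_cases h : Equiv.swap i j a = b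
  · subst h
    have : (Pi.mulSingle i u : Fin n → ℚ_[p]ˣ) a =
        (Pi.mulSingle j u : Fin n → ℚ_[p]ˣ) (Equiv.swap i j a) := by
      simp only [Pi.mulSingle_apply, Equiv.swap_apply_def]
      split_ifs <;> simp_all
    simp [this]
  · simp [h]

/-- A character of `GL_n(ℚ_p)` with positive values that is trivial on `GL_n(ℤ_p)` and on the
scalar matrices is trivial. It kills the transvections, because some power of a transvection is
integral, and the diagonal matrices, because their entries are permuted by `GL_n(ℤ_p)`. -/
theorem char_eq_one_of_trivial_on_maxCompact_of_trivial_on_scalar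
    (χ : GL (Fin n) ℚ_[p] →* NNReal) (hK : ∀ k ∈ maxCompact p n, χ k = 1)
    (hZ : ∀ u : ℚ_[p]ˣ, χ (torus p n fun _ => u) = 1) (g : GL (Fin n) ℚ_[p]) : χ g = 1 := by
  have hsingle : ∀ (i : Fin n) (u : ℚ_[p]ˣ), χ (torus p n (Pi.mulSingle i u)) = 1 := by
    intro i u
    have hj : ∀ j, χ (torus p n (Pi.mulSingle j u)) = χ (torus p n (Pi.mulSingle i u)) := by
      intro j
      have := congrArg χ (torus_mulSingle_mul_swap i j u)
      simpa [map_mul, hK _ (swap_mem_maxCompact i j)] using this.symm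
    have h1 : (χ.comp (torus p n)) (∏ j, Pi.mulSingle j u) = 1 := by
      rw [Finset.univ_prod_mulSingle (fun _ : Fin n => u)]
      exact hZ u
    rw [map_prod] at h1
    simp only [MonoidHom.comp_apply, hj, Finset.prod_const, Finset.card_univ,
      Fintype.card_fin] at h1
    exact (pow_eq_one_iff_of_nonneg zero_le (Nat.pos_of_ne_zero
      (by rintro rfl; exact i.elim0)).ne').1 h1
  have key : ∀ M : Matrix (Fin n) (Fin n) ℚ_[p], M.det ≠ 0 →
      ∀ g : GL (Fin n) ℚ_[p], (g : Matrix (Fin n) (Fin n) ℚ_[p]) = M → χ g = 1 := by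
    intro M hM
    refine Matrix.diagonal_transvection_induction_of_det_ne_zero
      (fun M => ∀ g : GL (Fin n) ℚ_[p], (g : Matrix (Fin n) (Fin n) ℚ_[p]) = M → χ g = 1)
      M hM ?_ ?_ ?_
    · intro D hD g hg
      rw [Matrix.det_diagonal, Finset.prod_ne_zero_iff] at hD
      have : g = torus p n (fun i => Units.mk0 (D i) (hD i (Finset.mem_univ i))) :=
        Units.ext (by rw [hg, torus_val]; rfl)
      rw [this, ← Finset.univ_prod_mulSingle fun i => Units.mk0 (D i) (hD i (Finset.mem_univ i)),
        ← MonoidHom.comp_apply, map_prod]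
      exact Finset.prod_eq_one fun i _ => hsingle i _
    · rintro ⟨i, j, hij, c⟩ g hg
      have hpow : ∀ m : ℕ, ((g ^ m : GL (Fin n) ℚ_[p]) : Matrix (Fin n) (Fin n) ℚ_[p]) =
          Matrix.transvection i j (m * c) := by
        intro m
        induction m with
        | zero => simp [Matrix.transvection]
        | succ m ih =>
          rw [pow_succ, Units.val_mul, ih, hg, Matrix.TransvectionStruct.toMatrix_mk,
            Matrix.transvection_mul_transvection_same i j hij]
          push_cast
          rw [add_mul, one_mul]
      obtain ⟨N, hN⟩ := pow_unbounded_of_one_lt ‖c‖ (one_lt_p p)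
      have hc : ‖((p ^ N : ℕ) : ℚ_[p]) * c‖ ≤ 1 := by
        rw [norm_mul, Nat.cast_pow, norm_pow, Padic.norm_p, inv_pow,
          inv_mul_le_iff₀ (pow_pos (p_pos p) N), mul_one]
        exact hN.le
      have h1 := hK _ (mem_maxCompact_of_eq_transvection hij hc _ (hpow (p ^ N)))
      rw [map_pow] at h1
      exact (pow_eq_one_iff_of_nonneg zero_le
        (pow_ne_zero _ (Fact.out : p.Prime).ne_zero)).1 h1
    · intro A B hA hB ihA ihB g hg
      have : g = Matrix.GeneralLinearGroup.mkOfDetNeZero A hA *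
          Matrix.GeneralLinearGroup.mkOfDetNeZero B hB := Units.ext hg
      rw [this, map_mul, ihA _ rfl, ihB _ rfl, one_mul]
  exact key g (Matrix.GeneralLinearGroup.det_ne_zero g) g rfl

instance instIsHaarMeasureGLHaar : (glHaar p n).IsHaarMeasure := by
  unfold glHaar; infer_instance

instance instRegularGLHaar : (glHaar p n).Regular := by
  unfold glHaar; infer_instance

theorem measurableSet_maxCompact : MeasurableSet (maxCompact p n : Set (GL (Fin n) ℚ_[p])) :=
  (isOpen_maxCompact p n).measurableSet

theorem glHaar_maxCompact : glHaar p n (maxCompact p n) = 1 :=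
  Measure.haarMeasure_self (K₀ := maxCompactPC p n)

theorem commute_torus_const (u : ℚ_[p]ˣ) (g : GL (Fin n) ℚ_[p]) :
    g * torus p n (fun _ => u) = torus p n (fun _ => u) * g := by
  refine Units.ext ?_
  ext a b
  simp [torus_val, Matrix.diagonal_mul, Matrix.mul_diagonal, mul_comm]

/-- `GL_n(ℚ_p)` is unimodular. -/
instance instIsMulRightInvariantGLHaar : (glHaar p n).IsMulRightInvariant := by
  have hmap := Measure.map_right_mul_eq_modularCharacterFun_smul (glHaar p n)
  have heval : ∀ g : GL (Fin n) ℚ_[p], glHaar p n ((· * g) ⁻¹' (maxCompact p n)) =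
      Measure.modularCharacter g := by
    intro g
    rw [← Measure.map_apply (measurable_mul_const g) measurableSet_maxCompact, hmap g,
      Measure.smul_apply, glHaar_maxCompact]
    simp [Measure.modularCharacter, ENNReal.smul_def]
  have h1 := char_eq_one_of_trivial_on_maxCompact_of_trivial_on_scalar
    (p := p) (n := n) Measure.modularCharacter
    (fun k hk => by
      have : (· * k) ⁻¹' (maxCompact p n : Set (GL (Fin n) ℚ_[p])) = maxCompact p n := by
        ext x
        exact (maxCompact p n).mul_mem_cancel_right hk
      have h := heval k
      rw [this, glHaar_maxCompact] at h
      exact_mod_cast h.symm)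
    (fun u => by
      have h := heval (torus p n fun _ => u)
      simp only [commute_torus_const] at h
      rw [measure_preimage_mul, glHaar_maxCompact] at h
      exact_mod_cast h.symm)
  refine ⟨fun g => ?_⟩
  rw [hmap g]
  have : Measure.modularCharacterFun g = 1 := h1 g
  rw [this, one_smul]

instance instIsInvInvariantGLHaar : (glHaar p n).IsInvInvariant := by
  refine ⟨?_⟩
  have h := Measure.isMulLeftInvariant_eq_smul (glHaar p n).inv (glHaar p n)
  have h2 := congrArg (fun μ : Measure (GL (Fin n) ℚ_[p]) => μ (maxCompact p n)) h
  simp only [Measure.inv_apply, Measure.smul_apply, glHaar_maxCompact, inv_coe_set] at h2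
  have h3 : (glHaar p n).inv.haarScalarFactor (glHaar p n) = 1 := by
    simpa [ENNReal.smul_def, eq_comm] using h2
  rw [h, h3, one_smul]

/-! ### The action of `GL_n(ℚ_p)` on `ℚ_p^n` -/

theorem norm_mulVec_le {A : Matrix (Fin n) (Fin n) ℚ_[p]} {C : ℝ} (hC : 0 ≤ C)
    (hA : ∀ i j, ‖A i j‖ ≤ C) (x : Fin n → ℚ_[p]) : ‖A *ᵥ x‖ ≤ C * ‖x‖ := by
  refine (pi_norm_le_iff_of_nonneg (by positivity)).2 fun i => ?_
  rw [Matrix.mulVec, dotProduct]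
  refine IsUltrametricDist.norm_sum_le_of_forall_le_of_nonneg (by positivity) fun j _ => ?_
  rw [norm_mul]
  exact mul_le_mul (hA i j) (norm_le_pi_norm x j) (norm_nonneg _) hC

theorem exists_norm_mulVec_le (A : Matrix (Fin n) (Fin n) ℚ_[p]) :
    ∃ m : ℤ, ∀ x : Fin n → ℚ_[p], ‖A *ᵥ x‖ ≤ (p : ℝ) ^ m * ‖x‖ := by
  obtain ⟨N, hN⟩ := pow_unbounded_of_one_lt (∑ i, ∑ j, ‖A i j‖) (one_lt_p p)
  refine ⟨N, norm_mulVec_le (zpow_p_pos _).le fun i j => ?_⟩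
  rw [zpow_natCast]
  refine le_trans ?_ hN.le
  refine (Finset.single_le_sum (f := fun j => ‖A i j‖) (fun _ _ => norm_nonneg _)
    (Finset.mem_univ j)).trans ?_
  exact Finset.single_le_sum (f := fun i => ∑ j, ‖A i j‖)
    (fun _ _ => Finset.sum_nonneg fun _ _ => norm_nonneg _) (Finset.mem_univ i)

theorem mulVec_inv_mulVec (g : GL (Fin n) ℚ_[p]) (x : Fin n → ℚ_[p]) :
    (g : Matrix (Fin n) (Fin n) ℚ_[p]) *ᵥ ((↑g⁻¹ : Matrix (Fin n) (Fin n) ℚ_[p]) *ᵥ x) = x := by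
  rw [Matrix.mulVec_mulVec, ← Units.val_mul, mul_inv_cancel, Units.val_one, Matrix.one_mulVec]

theorem inv_mulVec_mulVec (g : GL (Fin n) ℚ_[p]) (x : Fin n → ℚ_[p]) :
    (↑g⁻¹ : Matrix (Fin n) (Fin n) ℚ_[p]) *ᵥ ((g : Matrix (Fin n) (Fin n) ℚ_[p]) *ᵥ x) = x := by
  rw [Matrix.mulVec_mulVec, ← Units.val_mul, inv_mul_cancel, Units.val_one, Matrix.one_mulVec]

theorem mulVec_ne_zero (g : GL (Fin n) ℚ_[p]) {x : Fin n → ℚ_[p]} (hx : x ≠ 0) :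
    (g : Matrix (Fin n) (Fin n) ℚ_[p]) *ᵥ x ≠ 0 := fun h => hx <| by
  rw [← inv_mulVec_mulVec g x, h, Matrix.mulVec_zero]

theorem norm_mulVec_of_mem_maxCompact {k : GL (Fin n) ℚ_[p]} (hk : k ∈ maxCompact p n)
    (x : Fin n → ℚ_[p]) : ‖(k : Matrix (Fin n) (Fin n) ℚ_[p]) *ᵥ x‖ = ‖x‖ := by
  rw [mem_maxCompact_iff] at hk
  refine le_antisymm (by simpa using norm_mulVec_le zero_le_one hk.1 x) ?_
  conv_lhs => rw [← inv_mulVec_mulVec k x]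
  simpa using norm_mulVec_le zero_le_one hk.2 ((k : Matrix (Fin n) (Fin n) ℚ_[p]) *ᵥ x)

theorem exists_mem_maxCompact_mulVec_single {x : Fin n → ℚ_[p]} (hx : x ≠ 0) {i : Fin n}
    (hi : ‖x i‖ = ‖x‖) {c : ℚ_[p]} (hc : ‖c‖ = ‖x‖) :
    ∃ k ∈ maxCompact p n, (k : Matrix (Fin n) (Fin n) ℚ_[p]) *ᵥ (Pi.single i c) = x := by
  have hxn : 0 < ‖x‖ := norm_pos_iff.2 hx
  have hc0 : c ≠ 0 := norm_pos_iff.1 (hc ▸ hxn)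
  have hle : ∀ j, ‖x j / c‖ ≤ 1 := fun j => by
    rw [norm_div, hc, div_le_one hxn]
    exact norm_le_pi_norm x j
  let w : Fin n → ℤ_[p] := fun j => ⟨x j / c, hle j⟩
  -- the identity matrix with its `i`-th column replaced by `x / c` has determinant `x i / c`
  let A : Matrix (Fin n) (Fin n) ℤ_[p] := Matrix.updateCol 1 i w
  have hdet : IsUnit A.det := by
    have : A.det = w i := by
      rw [← Matrix.cramer_apply, Matrix.cramer_one]
      rfl
    rw [this, PadicInt.isUnit_iff, PadicInt.norm_def]
    change ‖x i / c‖ = 1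
    rw [norm_div, hi, hc, div_self hxn.ne']
  obtain ⟨u, hu⟩ := (Matrix.isUnit_iff_isUnit_det A).2 hdet
  refine ⟨Matrix.GeneralLinearGroup.map (n := Fin n) (algebraMap ℤ_[p] ℚ_[p]) u, ⟨u, rfl⟩, ?_⟩
  have : ((Matrix.GeneralLinearGroup.map (n := Fin n) (algebraMap ℤ_[p] ℚ_[p]) u :
      GL (Fin n) ℚ_[p]) : Matrix (Fin n) (Fin n) ℚ_[p]) = A.map (algebraMap ℤ_[p] ℚ_[p]) := by
    rw [← hu]; rfl
  rw [this]
  ext j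
  rw [Matrix.mulVec_single]
  simp only [A, MulOpposite.smul_eq_mul_unop, Pi.smul_apply, Matrix.col_apply, Matrix.map_apply,
    Matrix.updateCol_self, MulOpposite.unop_op]
  exact div_mul_cancel₀ _ hc0

/-- `GL_n(ℤ_p)` acts transitively on each sphere. -/
theorem exists_mem_maxCompact_mulVec_eq {x y : Fin n → ℚ_[p]} (h : ‖x‖ = ‖y‖) :
    ∃ k ∈ maxCompact p n, (k : Matrix (Fin n) (Fin n) ℚ_[p]) *ᵥ x = y := by
  rcases eq_or_ne x 0 with rfl | hx
  · rw [norm_zero] at h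
    exact ⟨1, one_mem _, by rw [Matrix.mulVec_zero, norm_eq_zero.1 h.symm]⟩
  have hy : y ≠ 0 := by rw [← norm_ne_zero_iff, ← h]; exact norm_ne_zero_iff.2 hx
  have hn : 1 ≤ n := by
    rcases Nat.eq_zero_or_pos n with rfl | h
    · exact absurd (Subsingleton.elim x 0) hx
    · exact h
  obtain ⟨i, hi⟩ := exists_norm_apply_eq hn x
  obtain ⟨j, hj⟩ := exists_norm_apply_eq hn y
  obtain ⟨k₁, hk₁, h₁⟩ := exists_mem_maxCompact_mulVec_single hx hi hi
  obtain ⟨k₂, hk₂, h₂⟩ := exists_mem_maxCompact_mulVec_single hy hj (hi.trans h)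
  refine ⟨k₂ * Matrix.GeneralLinearGroup.swap ℚ_[p] j i * k₁⁻¹,
    mul_mem (mul_mem hk₂ (swap_mem_maxCompact j i)) (inv_mem hk₁), ?_⟩
  have h3 : (↑k₁⁻¹ : Matrix (Fin n) (Fin n) ℚ_[p]) *ᵥ x = Pi.single i (x i) := by
    conv_lhs => rw [← h₁]
    exact inv_mulVec_mulVec _ _
  rw [Units.val_mul, Units.val_mul, ← Matrix.mulVec_mulVec, h3, ← Matrix.mulVec_mulVec,
    swap_val, Matrix.swap_mulVec]
  have h4 : (Pi.single i (x i) : Fin n → ℚ_[p]) ∘ Equiv.swap j i = Pi.single j (x i) := by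
    ext a
    simp only [Function.comp_apply, Pi.single_apply, Equiv.swap_apply_def]
    split_ifs <;> simp_all
  rw [h4, h₂]

/-- The homeomorphism `x ↦ g x` of `ℚ_p^n`. -/
def mulVecHomeo (g : GL (Fin n) ℚ_[p]) : (Fin n → ℚ_[p]) ≃ₜ (Fin n → ℚ_[p]) where
  toFun x := (g : Matrix (Fin n) (Fin n) ℚ_[p]) *ᵥ x
  invFun x := (↑g⁻¹ : Matrix (Fin n) (Fin n) ℚ_[p]) *ᵥ x
  left_inv := inv_mulVec_mulVec g
  right_inv := mulVec_inv_mulVec g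
  continuous_toFun := continuous_const.matrix_mulVec continuous_id
  continuous_invFun := continuous_const.matrix_mulVec continuous_id

theorem continuous_mulVec (g : GL (Fin n) ℚ_[p]) :
    Continuous fun x => (g : Matrix (Fin n) (Fin n) ℚ_[p]) *ᵥ x := (mulVecHomeo g).continuous

theorem isAddHaarMeasure_map_mulVec (g : GL (Fin n) ℚ_[p]) :
    (Measure.map (fun x => (g : Matrix (Fin n) (Fin n) ℚ_[p]) *ᵥ x)
      (vecHaar p n)).IsAddHaarMeasure :=
  AddEquiv.isAddHaarMeasure_map (vecHaar p n)
    { (mulVecHomeo g).toEquiv with map_add' := fun x y => Matrix.mulVec_add _ x y }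
    (mulVecHomeo g).continuous (mulVecHomeo g).symm.continuous

theorem norm_det_of_mem_maxCompact {k : GL (Fin n) ℚ_[p]} (hk : k ∈ maxCompact p n) :
    ‖(k : Matrix (Fin n) (Fin n) ℚ_[p]).det‖ = 1 := by
  obtain ⟨u, rfl⟩ := hk
  have h1 : ((Matrix.GeneralLinearGroup.map (n := Fin n) (algebraMap ℤ_[p] ℚ_[p]) u :
      GL (Fin n) ℚ_[p]) : Matrix (Fin n) (Fin n) ℚ_[p]).det =
      algebraMap ℤ_[p] ℚ_[p] (u : Matrix (Fin n) (Fin n) ℤ_[p]).det :=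
    ((algebraMap ℤ_[p] ℚ_[p]).map_det _).symm
  have h2 : IsUnit (u : Matrix (Fin n) (Fin n) ℤ_[p]).det :=
    (Matrix.isUnit_iff_isUnit_det _).1 u.isUnit
  rw [PadicInt.isUnit_iff, PadicInt.norm_def] at h2
  rw [h1]
  exact h2

/-- Elements of `GL_n(ℚ_p)` scale the Haar measure of `ℚ_p^n` by the absolute value of their
determinant. -/
theorem map_mulVec_vecHaar (g : GL (Fin n) ℚ_[p]) :
    Measure.map (fun x => (g : Matrix (Fin n) (Fin n) ℚ_[p]) *ᵥ x) (vecHaar p n) =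
      ‖(g : Matrix (Fin n) (Fin n) ℚ_[p]).det‖₊⁻¹ • vecHaar p n := by
  let T : GL (Fin n) ℚ_[p] → Measure (Fin n → ℚ_[p]) := fun g =>
    Measure.map (fun x => (g : Matrix (Fin n) (Fin n) ℚ_[p]) *ᵥ x) (vecHaar p n)
  have hex : ∀ g, ∃ c : NNReal, T g = c • vecHaar p n := fun g => by
    have := isAddHaarMeasure_map_mulVec g
    exact ⟨_, Measure.isAddLeftInvariant_eq_smul _ _⟩
  choose r hr using hex
  have hball : vecHaar p n (pBall p n 0) = 1 := by rw [vecHaar_pBall]; simp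
  have heval : ∀ g, (r g : ENNReal) = vecHaar p n
      ((fun x => (g : Matrix (Fin n) (Fin n) ℚ_[p]) *ᵥ x) ⁻¹' (pBall p n 0)) := fun g => by
    rw [← Measure.map_apply (continuous_mulVec g).measurable (measurableSet_pBall 0)]
    change _ = T g _
    rw [hr g, Measure.smul_apply, hball, ENNReal.smul_def, smul_eq_mul, mul_one]
  have hone : r 1 = 1 := by
    have := heval 1
    simp only [Units.val_one, Matrix.one_mulVec, Set.preimage_id', hball] at this
    exact_mod_cast this
  have hmul : ∀ g h, r (g * h) = r g * r h := fun g h => by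
    have h1 : T (g * h) = Measure.map (fun x => (g : Matrix (Fin n) (Fin n) ℚ_[p]) *ᵥ x) (T h) := by
      simp only [T]
      rw [Measure.map_map (continuous_mulVec g).measurable (continuous_mulVec h).measurable]
      congr 1
      ext x
      simp [Matrix.mulVec_mulVec]
    have h2 : T (g * h) = (r h * r g) • vecHaar p n := by
      rw [h1, hr h, Measure.map_smul, mul_smul]
      exact congrArg _ (hr g)
    have h3 := (hr (g * h)).symm.trans h2
    have h4 := congrArg (fun μ : Measure (Fin n → ℚ_[p]) => μ (pBall p n 0)) h3
    simp only [Measure.smul_apply, hball, ENNReal.smul_def, smul_eq_mul, mul_one] at h4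
    rw [mul_comm]
    exact_mod_cast h4
  let χ : GL (Fin n) ℚ_[p] →* NNReal :=
    { toFun := fun g => r g * ‖(g : Matrix (Fin n) (Fin n) ℚ_[p]).det‖₊
      map_one' := by simp [hone]
      map_mul' := fun g h => by
        rw [hmul, Units.val_mul, Matrix.det_mul, nnnorm_mul]
        ring }
  have hdetK : ∀ k ∈ maxCompact p n, ‖(k : Matrix (Fin n) (Fin n) ℚ_[p]).det‖₊ = 1 :=
    fun k hk => NNReal.eq (norm_det_of_mem_maxCompact hk)
  have h1 := char_eq_one_of_trivial_on_maxCompact_of_trivial_on_scalar χ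
    (fun k hk => by
      change r k * _ = 1
      rw [hdetK k hk, mul_one]
      have h := heval k
      have : (fun x => (k : Matrix (Fin n) (Fin n) ℚ_[p]) *ᵥ x) ⁻¹' (pBall p n 0) =
          pBall p n 0 := by
        ext x
        simp [mem_pBall, norm_mulVec_of_mem_maxCompact hk]
      rw [this, hball] at h
      exact_mod_cast h)
    (fun u => by
      change r _ * _ = 1
      obtain ⟨j, hj⟩ := exists_norm_eq_zpow_padic u.ne_zero
      have h := heval (torus p n fun _ => u)
      have : (fun x => ((torus p n fun _ => u : GL (Fin n) ℚ_[p]) :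
          Matrix (Fin n) (Fin n) ℚ_[p]) *ᵥ x) ⁻¹' (pBall p n 0) = pBall p n (-j) := by
        ext x
        have hx : ((torus p n fun _ => u : GL (Fin n) ℚ_[p]) :
            Matrix (Fin n) (Fin n) ℚ_[p]) *ᵥ x = (u : ℚ_[p]) • x := by
          ext i
          simp [torus_val, Matrix.mulVec_diagonal]
        rw [Set.mem_preimage, hx, mem_pBall, mem_pBall, norm_smul, hj, zpow_zero, zpow_neg,
          ← one_div, le_div_iff₀ (zpow_p_pos j), mul_comm]
      rw [this, vecHaar_pBall] at h
      have h5 : r (torus p n fun _ => u) = Real.toNNReal ((p : ℝ) ^ (-j * n)) :=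
        ENNReal.coe_injective h
      rw [h5, torus_val, Matrix.det_diagonal, Finset.prod_const, Finset.card_univ,
        Fintype.card_fin]
      refine NNReal.eq ?_
      rw [NNReal.coe_mul, Real.coe_toNNReal _ (zpow_p_pos _).le, coe_nnnorm, norm_pow, hj,
        ← zpow_natCast, ← zpow_mul, ← zpow_add₀ (p_pos p).ne']
      simp)
  have h2 : r g * ‖(g : Matrix (Fin n) (Fin n) ℚ_[p]).det‖₊ = 1 := h1 g
  have h3 : r g = ‖(g : Matrix (Fin n) (Fin n) ℚ_[p]).det‖₊⁻¹ := eq_inv_of_mul_eq_one_left h2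
  rw [← h3]
  exact hr g

theorem norm_det_pos (g : GL (Fin n) ℚ_[p]) : 0 < ‖(g : Matrix (Fin n) (Fin n) ℚ_[p]).det‖ :=
  norm_pos_iff.2 (Matrix.GeneralLinearGroup.det_ne_zero g)

theorem integral_comp_mulVec (g : GL (Fin n) ℚ_[p]) (F : (Fin n → ℚ_[p]) → ℂ) :
    ∫ x, F ((g : Matrix (Fin n) (Fin n) ℚ_[p]) *ᵥ x) ∂(vecHaar p n) =
      ((‖(g : Matrix (Fin n) (Fin n) ℚ_[p]).det‖⁻¹ : ℝ) : ℂ) * ∫ x, F x ∂(vecHaar p n) := by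
  have h := (mulVecHomeo g).isClosedEmbedding.measurableEmbedding.integral_map
    (μ := vecHaar p n) F
  change _ = ∫ x, F ((g : Matrix (Fin n) (Fin n) ℚ_[p]) *ᵥ x) ∂(vecHaar p n) at h
  rw [← h]
  change ∫ x, F x ∂(Measure.map (fun x => (g : Matrix (Fin n) (Fin n) ℚ_[p]) *ᵥ x)
    (vecHaar p n)) = _
  rw [map_mulVec_vecHaar, integral_smul_nnreal_measure]
  simp [NNReal.smul_def]

end Group

/-! ### Integrals of powers of the norm -/

section NormPow

variable {p : ℕ} [Fact p.Prime] {n : ℕ}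

theorem p_ne_zero_complex : (p : ℂ) ≠ 0 := by exact_mod_cast (Fact.out : p.Prime).ne_zero

theorem p_cpow_ne_zero (s : ℂ) : (p : ℂ) ^ s ≠ 0 :=
  fun h => p_ne_zero_complex ((Complex.cpow_eq_zero_iff _ _).1 h).1

theorem norm_p_cpow (s : ℂ) : ‖(p : ℂ) ^ s‖ = (p : ℝ) ^ s.re :=
  Complex.norm_natCast_cpow_of_pos (Fact.out : p.Prime).pos s

theorem zpow_p_cpow (k : ℤ) (t : ℂ) : (((p : ℝ) ^ k : ℝ) : ℂ) ^ t = ((p : ℂ) ^ t) ^ k := by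
  have h : (((p : ℝ) ^ k : ℝ) : ℂ) ≠ 0 := by exact_mod_cast (zpow_p_pos (p := p) k).ne'
  rw [← Complex.cpow_mul_int, Complex.cpow_def_of_ne_zero h,
    Complex.cpow_def_of_ne_zero p_ne_zero_complex, ← Complex.ofReal_log (zpow_p_pos k).le,
    Real.log_zpow, ← Complex.ofReal_natCast p, ← Complex.ofReal_log (p_pos p).le]
  push_cast
  ring_nf

theorem normPow_of_mem_pSphere {k : ℤ} {x : Fin n → ℚ_[p]} (hx : x ∈ pSphere p n k) (t : ℂ) :
    normPow t x = ((p : ℂ) ^ t) ^ k := by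
  rw [normPow, mem_pSphere.1 hx, zpow_p_cpow]

theorem normPow_smul (t : ℂ) (c : ℚ_[p]) (x : Fin n → ℚ_[p]) :
    normPow t (c • x) = (‖c‖ : ℂ) ^ t * normPow t x := by
  rw [normPow, normPow, norm_smul, Complex.ofReal_mul,
    Complex.mul_cpow_ofReal_nonneg (norm_nonneg _) (norm_nonneg _)]

theorem continuousAt_normPow (t : ℂ) {x : Fin n → ℚ_[p]} (hx : x ≠ 0) :
    ContinuousAt (normPow t) x := by
  have h : ContinuousAt (fun x : Fin n → ℚ_[p] => (‖x‖ : ℂ)) x :=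
    (Complex.continuous_ofReal.comp continuous_norm).continuousAt
  exact h.cpow continuousAt_const (Complex.ofReal_mem_slitPlane.2 (norm_pos_iff.2 hx))

theorem zero_notMem_pSphere (k : ℤ) : (0 : Fin n → ℚ_[p]) ∉ pSphere p n k := by
  rw [mem_pSphere, norm_zero]
  exact (zpow_p_pos k).ne

theorem vecHaar_real_pSphere (k : ℤ) :
    (vecHaar p n).real (pSphere p n k) = (p : ℝ) ^ (k * n) - (p : ℝ) ^ ((k - 1) * n) := by
  rw [← pBall_sdiff_pBall_sub_one, measureReal_sdiff (pBall_mono (by omega)) (measurableSet_pBall _)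
    (isCompact_pBall _).measure_lt_top.ne, vecHaar_real_pBall, vecHaar_real_pBall]

theorem vecHaar_real_pSphere_pos (hn : 1 ≤ n) (k : ℤ) :
    0 < (vecHaar p n).real (pSphere p n k) := by
  rw [vecHaar_real_pSphere, sub_pos, zpow_p_lt]
  have : (1 : ℤ) ≤ n := by exact_mod_cast hn
  nlinarith

theorem pSphere_nonempty (hn : 1 ≤ n) (k : ℤ) : (pSphere p n k).Nonempty := by
  by_contra h
  rw [Set.not_nonempty_iff_eq_empty] at h
  have := vecHaar_real_pSphere_pos (p := p) hn k
  simp [h] at this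

theorem vecHaar_pSphere_lt_top (k : ℤ) : vecHaar p n (pSphere p n k) < ⊤ :=
  (measure_mono (pSphere_subset_pBall k)).trans_lt (isCompact_pBall k).measure_lt_top

theorem iUnion_pSphere : ⋃ k : ℤ, pSphere p n k = {0}ᶜ := by
  ext x
  simp only [Set.mem_iUnion, Set.mem_compl_iff, Set.mem_singleton_iff]
  refine ⟨?_, fun h => exists_norm_eq_zpow h⟩
  rintro ⟨k, hk⟩ rfl
  exact zero_notMem_pSphere k hk

theorem iUnion_pSphere_sub (N : ℤ) : ⋃ m : ℕ, pSphere p n (N - m) = pBall p n N \ {0} := by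
  ext x
  simp only [Set.mem_iUnion, Set.mem_sdiff, Set.mem_singleton_iff]
  constructor
  · rintro ⟨m, hm⟩
    refine ⟨pBall_mono (by omega) (pSphere_subset_pBall _ hm), ?_⟩
    rintro rfl
    exact zero_notMem_pSphere _ hm
  · rintro ⟨h, h0⟩
    obtain ⟨k, hk⟩ := exists_norm_eq_zpow h0
    rw [mem_pBall, hk, zpow_p_le] at h
    exact ⟨(N - k).toNat, by rw [mem_pSphere, hk, Int.toNat_of_nonneg (by omega), sub_sub_cancel]⟩

theorem integral_eq_zero_of_forall_pSphere (hn : 1 ≤ n) {h : (Fin n → ℚ_[p]) → ℂ}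
    (hint : Integrable h (vecHaar p n)) (h0 : ∀ k, ∫ x in pSphere p n k, h x ∂(vecHaar p n) = 0) :
    ∫ x, h x ∂(vecHaar p n) = 0 := by
  have h1 := hasSum_integral_iUnion (fun k => measurableSet_pSphere k) pairwise_disjoint_pSphere
    (hint.integrableOn (s := ⋃ k : ℤ, pSphere p n k))
  simp only [h0, iUnion_pSphere] at h1
  rw [← h1.unique hasSum_zero]
  rw [Measure.restrict_eq_self_of_ae_mem]
  exact compl_mem_ae_iff.2 (vecHaar_singleton_zero hn)

theorem integral_pSphere_normPow (k : ℤ) (s : ℂ) :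
    ∫ x in pSphere p n k, normPow (s - n) x ∂(vecHaar p n) =
      ((p : ℂ) ^ s) ^ k * (1 - ((p : ℂ) ^ n)⁻¹) := by
  rw [setIntegral_congr_fun (measurableSet_pSphere k)
    (fun x hx => normPow_of_mem_pSphere hx (s - n)), setIntegral_const, vecHaar_real_pSphere,
    Complex.real_smul, Complex.cpow_sub _ _ p_ne_zero_complex, Complex.cpow_natCast, div_zpow]
  have hp := p_ne_zero_complex (p := p)
  have h1 : ((p : ℂ) ^ n) ^ k ≠ 0 := zpow_ne_zero _ (pow_ne_zero _ hp)
  have h2 : (((p : ℝ) ^ (k * n : ℤ) - (p : ℝ) ^ ((k - 1) * n : ℤ) : ℝ) : ℂ) =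
      ((p : ℂ) ^ n) ^ k * (1 - ((p : ℂ) ^ n)⁻¹) := by
    push_cast
    rw [mul_comm k, mul_comm (k - 1), zpow_mul, zpow_mul, zpow_natCast,
      zpow_sub_one₀ (pow_ne_zero _ hp)]
    ring
  rw [h2]
  field_simp

theorem integrableOn_pBall_normPow (hn : 1 ≤ n) (N : ℤ) {s : ℂ} (hs : 0 < s.re) :
    IntegrableOn (normPow (s - n)) (pBall p n N) (vecHaar p n) := by
  have h1 : IntegrableOn (normPow (s - n)) (⋃ m : ℕ, pSphere p n (N - m)) (vecHaar p n) := by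
    refine integrableOn_iUnion_of_summable_integral_norm (fun m => ?_) ?_
    · refine IntegrableOn.congr_fun (f := fun _ => ((p : ℂ) ^ (s - n)) ^ (N - m))
        (integrableOn_const (vecHaar_pSphere_lt_top _).ne) (fun x hx => ?_)
        (measurableSet_pSphere _)
      exact (normPow_of_mem_pSphere hx _).symm
    · have h2 : ∀ m : ℕ, ∫ x in pSphere p n (N - m), ‖normPow (s - n) x‖ ∂(vecHaar p n) =
          ((p : ℝ) ^ s.re) ^ N * (1 - ((p : ℝ) ^ n)⁻¹) * (((p : ℝ) ^ s.re)⁻¹) ^ m := by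
        intro m
        have h3 := integral_pSphere_normPow (p := p) (n := n) (N - m) (s.re : ℂ)
        have h4 : ∀ x ∈ pSphere p n (N - m), ((‖normPow (s - n) x‖ : ℝ) : ℂ) =
            normPow ((s.re : ℂ) - n) x := by
          intro x hx
          rw [normPow_of_mem_pSphere hx, normPow_of_mem_pSphere hx, norm_zpow, norm_p_cpow]
          have : ((s.re : ℂ) - n) = ((s - n).re : ℂ) := by simp
          rw [this, ← Complex.ofReal_natCast p, ← Complex.ofReal_cpow (p_pos p).le]
          push_cast
          rfl
        rw [← setIntegral_congr_fun (measurableSet_pSphere _) h4] at h3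
        have h5 : ∫ x in pSphere p n (N - m), ‖normPow (s - n) x‖ ∂(vecHaar p n) =
          ((p : ℝ) ^ s.re) ^ (N - m : ℤ) * (1 - ((p : ℝ) ^ n)⁻¹) := by
          have h6 := integral_ofReal (𝕜 := ℂ) (μ := (vecHaar p n).restrict (pSphere p n (N - m)))
            (f := fun x => ‖normPow (s - n) x‖)
          have h7 := h6.symm.trans h3
          rw [← Complex.ofReal_natCast p, ← Complex.ofReal_cpow (p_pos p).le] at h7
          apply Complex.ofReal_injective
          rw [← RCLike.ofReal_eq_complex_ofReal]
          refine h7.trans ?_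
          push_cast
          rfl
        rw [h5, zpow_sub₀ (Real.rpow_pos_of_pos (p_pos p) _).ne', zpow_natCast, inv_pow]
        ring
      simp only [h2]
      refine Summable.mul_left _ (summable_geometric_of_lt_one ?_ ?_)
      · exact inv_nonneg.2 (Real.rpow_nonneg (p_pos p).le _)
      · exact inv_lt_one_of_one_lt₀ (Real.one_lt_rpow (one_lt_p p) hs)
  rw [iUnion_pSphere_sub] at h1
  refine h1.congr_set_ae ?_
  exact (sdiff_null_ae_eq_self (vecHaar_singleton_zero hn)).symm

theorem norm_inv_p_cpow_lt_one {s : ℂ} (hs : 0 < s.re) : ‖((p : ℂ) ^ s)⁻¹‖ < 1 := by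
  rw [norm_inv, norm_p_cpow]
  exact inv_lt_one_of_one_lt₀ (Real.one_lt_rpow (one_lt_p p) hs)

theorem integral_pBall_normPow (hn : 1 ≤ n) (N : ℤ) {s : ℂ} (hs : 0 < s.re) :
    ∫ x in pBall p n N, normPow (s - n) x ∂(vecHaar p n) =
      ((p : ℂ) ^ s) ^ N * (1 - ((p : ℂ) ^ n)⁻¹) * (1 - ((p : ℂ) ^ s)⁻¹)⁻¹ := by
  have h0 : (pBall p n N \ {0} : Set (Fin n → ℚ_[p])) =ᵐ[vecHaar p n] pBall p n N :=
    sdiff_null_ae_eq_self (vecHaar_singleton_zero hn)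
  have h1 := hasSum_integral_iUnion (μ := vecHaar p n) (f := normPow (s - n))
    (s := fun m : ℕ => pSphere p n (N - m)) (fun m => measurableSet_pSphere _)
    (fun i j hij => pairwise_disjoint_pSphere (by simpa using hij))
    (by
      rw [iUnion_pSphere_sub]
      exact (integrableOn_pBall_normPow hn N hs).mono_set Set.sdiff_subset)
  rw [iUnion_pSphere_sub, setIntegral_congr_set h0] at h1
  have h2 := (hasSum_geometric_of_norm_lt_one (norm_inv_p_cpow_lt_one (p := p) hs)).mul_left
    (((p : ℂ) ^ s) ^ N * (1 - ((p : ℂ) ^ n)⁻¹))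
  refine h1.unique (h2.congr_fun fun m => ?_)
  rw [integral_pSphere_normPow, zpow_sub₀ (p_cpow_ne_zero s), zpow_natCast, inv_pow]
  ring

end NormPow

/-! ### The action of the Hecke algebra on functions -/

section Hecke

variable {p : ℕ} [Fact p.Prime] {n : ℕ}

/-- The indicator function of `K = GL_n(ℤ_p)`, the unit of the Hecke algebra. The operator
`lam (kInd p n)` is averaging over `K`. -/
def kInd (p : ℕ) [Fact p.Prime] (n : ℕ) : GL (Fin n) ℚ_[p] → ℂ :=
  Set.indicator (maxCompact p n : Set (GL (Fin n) ℚ_[p])) 1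

theorem kInd_of_mem {g : GL (Fin n) ℚ_[p]} (hg : g ∈ maxCompact p n) : kInd p n g = 1 :=
  Set.indicator_of_mem hg _

theorem kInd_of_notMem {g : GL (Fin n) ℚ_[p]} (hg : g ∉ maxCompact p n) : kInd p n g = 0 :=
  Set.indicator_of_notMem hg _

theorem isClopen_maxCompact : IsClopen (maxCompact p n : Set (GL (Fin n) ℚ_[p])) :=
  ⟨(isCompact_maxCompact p n).isClosed, isOpen_maxCompact p n⟩

theorem isLocallyConstant_kInd : IsLocallyConstant (kInd p n) :=
  (IsLocallyConstant.iff_exists_open _).2 fun x => by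
    by_cases hx : x ∈ maxCompact p n
    · exact ⟨_, isClopen_maxCompact.2, hx, fun y hy => by rw [kInd_of_mem hx, kInd_of_mem hy]⟩
    · exact ⟨_, isClopen_maxCompact.1.isOpen_compl, hx, fun y hy => by
        rw [kInd_of_notMem hx, kInd_of_notMem hy]⟩

theorem hasCompactSupport_kInd : HasCompactSupport (kInd p n) :=
  HasCompactSupport.intro (isCompact_maxCompact p n) fun _ hx => kInd_of_notMem hx

theorem isHecke_kInd : IsHecke (kInd p n) where
  isLocallyConstant := isLocallyConstant_kInd
  hasCompactSupport := hasCompactSupport_kInd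
  biinvariant := fun k₁ h₁ k₂ h₂ g => by
    have : k₁ * g * k₂ ∈ maxCompact p n ↔ g ∈ maxCompact p n := by
      rw [(maxCompact p n).mul_mem_cancel_right h₂, (maxCompact p n).mul_mem_cancel_left h₁]
    by_cases hg : g ∈ maxCompact p n
    · rw [kInd_of_mem hg, kInd_of_mem (this.2 hg)]
    · rw [kInd_of_notMem hg, kInd_of_notMem fun h => hg (this.1 h)]

theorem integral_kInd : ∫ g, kInd p n g ∂(glHaar p n) = 1 := by
  rw [kInd, integral_indicator measurableSet_maxCompact]
  simp [measureReal_def, glHaar_maxCompact]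

theorem integrable_kInd_mul {H : GL (Fin n) ℚ_[p] → ℂ} (hH : Continuous H) :
    Integrable (fun g => kInd p n g * H g) (glHaar p n) :=
  (isLocallyConstant_kInd.continuous.mul hH).integrable_of_hasCompactSupport
    (hasCompactSupport_kInd.mul_right)

theorem integral_kInd_mul_inv (H : GL (Fin n) ℚ_[p] → ℂ) :
    ∫ g, kInd p n g * H g⁻¹ ∂(glHaar p n) = ∫ g, kInd p n g * H g ∂(glHaar p n) := by
  rw [← integral_inv_eq_self (fun g => kInd p n g * H g)]
  refine integral_congr_ae (Filter.Eventually.of_forall fun g => ?_)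
  by_cases hg : g ∈ maxCompact p n
  · simp [kInd_of_mem hg, kInd_of_mem (inv_mem hg)]
  · have : g⁻¹ ∉ maxCompact p n := fun h => hg (by simpa using inv_mem h)
    simp [kInd_of_notMem hg, kInd_of_notMem this]

/-- A Hecke function is a finite linear combination of indicator functions of cosets `g K`. -/
theorem IsHecke.exists_finset {φ : GL (Fin n) ℚ_[p] → ℂ} (hφ : IsHecke φ) :
    ∃ S : Finset (GL (Fin n) ℚ_[p]), ∀ x, φ x = ∑ g ∈ S, φ g * kInd p n (g⁻¹ * x) := by
  classical
  have hdisc : DiscreteTopology (GL (Fin n) ℚ_[p] ⧸ maxCompact p n) :=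
    QuotientGroup.discreteTopology (isOpen_maxCompact p n)
  have hfin : ((QuotientGroup.mk : _ → GL (Fin n) ℚ_[p] ⧸ maxCompact p n) '' tsupport φ).Finite :=
    (hφ.hasCompactSupport.isCompact.image QuotientGroup.continuous_mk).finite_of_discrete
  refine ⟨hfin.toFinset.image Quotient.out, fun x => ?_⟩
  have hout : ∀ q : GL (Fin n) ℚ_[p] ⧸ maxCompact p n, (q.out : _ ⧸ maxCompact p n) = q :=
    fun q => QuotientGroup.out_eq' q
  rw [Finset.sum_image fun a _ b _ h => by rw [← hout a, ← hout b, h]]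
  have hmem : ∀ q : GL (Fin n) ℚ_[p] ⧸ maxCompact p n,
      (q.out)⁻¹ * x ∈ maxCompact p n ↔ q = (x : GL (Fin n) ℚ_[p] ⧸ maxCompact p n) := fun q => by
    rw [← QuotientGroup.eq, hout]
  have h1 := (hmem x).2 rfl
  have h2 : φ x = φ (x : GL (Fin n) ℚ_[p] ⧸ maxCompact p n).out := by
    have h2 := hφ.biinvariant 1 (one_mem _) _ h1 (x : GL (Fin n) ℚ_[p] ⧸ maxCompact p n).out
    rwa [one_mul, mul_inv_cancel_left] at h2
  refine Eq.symm ((Finset.sum_eq_single (x : GL (Fin n) ℚ_[p] ⧸ maxCompact p n) ?_ ?_).trans ?_)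
  · intro q _ hq
    rw [kInd_of_notMem fun h => hq ((hmem q).1 h), mul_zero]
  · intro hx
    rw [← h2, kInd_of_mem h1, mul_one]
    have : x ∉ tsupport φ := fun h => hx (hfin.mem_toFinset.2 ⟨x, h, rfl⟩)
    exact image_eq_zero_of_notMem_tsupport this
  · rw [kInd_of_mem h1, mul_one, h2]

/-- Integration against a Hecke function, coset by coset. -/
theorem integral_mul_eq_sum {φ : GL (Fin n) ℚ_[p] → ℂ} {S : Finset (GL (Fin n) ℚ_[p])}
    (hS : ∀ x, φ x = ∑ g ∈ S, φ g * kInd p n (g⁻¹ * x)) {H : GL (Fin n) ℚ_[p] → ℂ}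
    (hH : Continuous H) : ∫ x, φ x * H x ∂(glHaar p n) =
      ∑ g ∈ S, φ g * ∫ k, kInd p n k * H (g * k) ∂(glHaar p n) := by
  have h1 : ∀ g, ∫ k, kInd p n k * H (g * k) ∂(glHaar p n) =
      ∫ x, kInd p n (g⁻¹ * x) * H x ∂(glHaar p n) := fun g => by
    rw [← integral_mul_left_eq_self (fun x => kInd p n (g⁻¹ * x) * H x) g]
    simp
  have h2 : ∀ g, Integrable (fun x => kInd p n (g⁻¹ * x) * H x) (glHaar p n) := fun g => by
    have := (integrable_kInd_mul (hH.comp (continuous_const_mul g))).comp_mul_left g⁻¹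
    simpa using this
  simp only [h1, ← integral_const_mul]
  rw [← integral_finsetSum _ fun g _ => (h2 g).const_mul (φ g)]
  refine integral_congr_ae (Filter.Eventually.of_forall fun x => ?_)
  simp only
  rw [hS x, Finset.sum_mul]
  exact Finset.sum_congr rfl fun g _ => mul_assoc _ _ _

theorem continuous_inv_mulVec (v : Fin n → ℚ_[p]) :
    Continuous fun g : GL (Fin n) ℚ_[p] => (↑g⁻¹ : Matrix (Fin n) (Fin n) ℚ_[p]) *ᵥ v :=
  (Units.continuous_val.comp continuous_inv).matrix_mulVec continuous_const

theorem continuous_mulVec_left (v : Fin n → ℚ_[p]) :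
    Continuous fun g : GL (Fin n) ℚ_[p] => (g : Matrix (Fin n) (Fin n) ℚ_[p]) *ᵥ v :=
  Units.continuous_val.matrix_mulVec continuous_const

theorem lam_eq_sum {φ : GL (Fin n) ℚ_[p] → ℂ} {S : Finset (GL (Fin n) ℚ_[p])}
    (hS : ∀ x, φ x = ∑ g ∈ S, φ g * kInd p n (g⁻¹ * x)) {F : (Fin n → ℚ_[p]) → ℂ}
    (hF : Continuous F) (v : Fin n → ℚ_[p]) : lam φ F v =
      ∑ g ∈ S, φ g * lam (kInd p n) F ((↑g⁻¹ : Matrix (Fin n) (Fin n) ℚ_[p]) *ᵥ v) := by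
  rw [lam, integral_mul_eq_sum hS
    (H := fun g => F ((↑g⁻¹ : Matrix (Fin n) (Fin n) ℚ_[p]) *ᵥ v))
    (hF.comp (continuous_inv_mulVec v))]
  refine Finset.sum_congr rfl fun g _ => ?_
  congr 1
  rw [lam]
  refine integral_congr_ae (Filter.Eventually.of_forall fun k => ?_)
  simp [Matrix.mulVec_mulVec]

theorem lam_mulVec_of_mem_maxCompact {φ : GL (Fin n) ℚ_[p] → ℂ}
    (hφ : ∀ k ∈ maxCompact p n, ∀ g, φ (k * g) = φ g) (F : (Fin n → ℚ_[p]) → ℂ)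
    {k : GL (Fin n) ℚ_[p]} (hk : k ∈ maxCompact p n) (v : Fin n → ℚ_[p]) :
    lam φ F ((k : Matrix (Fin n) (Fin n) ℚ_[p]) *ᵥ v) = lam φ F v := by
  rw [lam, lam, ← integral_mul_left_eq_self _ k]
  refine integral_congr_ae (Filter.Eventually.of_forall fun g => ?_)
  simp only [hφ k hk, mul_inv_rev, Matrix.mulVec_mulVec, Units.val_mul]
  rw [Matrix.mul_assoc, ← Units.val_mul k⁻¹ k, inv_mul_cancel, Units.val_one, Matrix.mul_one]

theorem lam_eq_of_norm_eq {φ : GL (Fin n) ℚ_[p] → ℂ}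
    (hφ : ∀ k ∈ maxCompact p n, ∀ g, φ (k * g) = φ g) (F : (Fin n → ℚ_[p]) → ℂ)
    {v w : Fin n → ℚ_[p]} (h : ‖v‖ = ‖w‖) : lam φ F v = lam φ F w := by
  obtain ⟨k, hk, rfl⟩ := exists_mem_maxCompact_mulVec_eq h
  exact (lam_mulVec_of_mem_maxCompact hφ F hk v).symm

theorem IsHecke.left_invariant {φ : GL (Fin n) ℚ_[p] → ℂ} (hφ : IsHecke φ) :
    ∀ k ∈ maxCompact p n, ∀ g, φ (k * g) = φ g := fun k hk g => by
  simpa using hφ.biinvariant k hk 1 (one_mem _) g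

theorem adj_left_invariant {φ : GL (Fin n) ℚ_[p] → ℂ} (hφ : IsHecke φ) :
    ∀ k ∈ maxCompact p n, ∀ g, adj φ (k * g) = adj φ g := fun k hk g => by
  have h := hφ.biinvariant 1 (one_mem _) k⁻¹ (inv_mem hk) g⁻¹
  rw [one_mul] at h
  rw [adj, adj, mul_inv_rev, h, Units.val_mul, Matrix.det_mul, norm_mul,
    norm_det_of_mem_maxCompact hk, one_mul]

/-- The function `‖x‖ ^ t` is an eigenfunction of the Hecke algebra: its image is invariant under
`K`, which is transitive on spheres, and homogeneous of degree `t`. -/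
theorem exists_isXi_adj (hn : 1 ≤ n) {φ : GL (Fin n) ℚ_[p] → ℂ} (hφ : IsHecke φ) (t : ℂ) :
    ∃ ξ, IsXi (adj φ) t ξ := by
  obtain ⟨e, he⟩ := pSphere_nonempty (p := p) hn 0
  rw [mem_pSphere, zpow_zero] at he
  refine ⟨lam (adj φ) (normPow t) e, fun x hx => ?_⟩
  obtain ⟨i, hi⟩ := exists_norm_apply_eq hn x
  have h1 : ‖x‖ = ‖x i • e‖ := by rw [norm_smul, he, mul_one, hi]
  rw [lam_eq_of_norm_eq (adj_left_invariant hφ) _ h1, mul_comm, lam, lam, ← integral_const_mul]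
  refine integral_congr_ae (Filter.Eventually.of_forall fun g => ?_)
  simp only [Matrix.mulVec_smul, normPow_smul, hi]
  rw [show normPow t x = (‖x‖ : ℂ) ^ t from rfl]
  ring

/-- The substitution `g ↦ g⁻¹`, which preserves the Haar measure because `GL_n(ℚ_p)` is unimodular,
turns `φ^*` into `|det g| φ(g)`. -/
theorem lam_adj_normPow_eq_sum {φ : GL (Fin n) ℚ_[p] → ℂ} {S : Finset (GL (Fin n) ℚ_[p])}
    (hS : ∀ x, φ x = ∑ g ∈ S, φ g * kInd p n (g⁻¹ * x)) (t : ℂ) {x : Fin n → ℚ_[p]}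
    (hx : x ≠ 0) : lam (adj φ) (normPow t) x =
      ∑ g ∈ S, φ g * ((‖(g : Matrix (Fin n) (Fin n) ℚ_[p]).det‖ : ℂ) *
        lam (kInd p n) (fun y => normPow t ((g : Matrix (Fin n) (Fin n) ℚ_[p]) *ᵥ y)) x) := by
  have hcont : Continuous fun g : GL (Fin n) ℚ_[p] =>
      (‖(g : Matrix (Fin n) (Fin n) ℚ_[p]).det‖ : ℂ) *
        normPow t ((g : Matrix (Fin n) (Fin n) ℚ_[p]) *ᵥ x) := by
    refine (Complex.continuous_ofReal.comp
      (continuous_norm.comp Units.continuous_val.matrix_det)).mul ?_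
    refine continuous_iff_continuousAt.2 fun g => ?_
    exact ContinuousAt.comp (f := fun g : GL (Fin n) ℚ_[p] =>
      (g : Matrix (Fin n) (Fin n) ℚ_[p]) *ᵥ x) (continuousAt_normPow t (mulVec_ne_zero g hx))
      (continuous_mulVec_left x).continuousAt
  have h1 : lam (adj φ) (normPow t) x = ∫ g, φ g *
      ((‖(g : Matrix (Fin n) (Fin n) ℚ_[p]).det‖ : ℂ) *
        normPow t ((g : Matrix (Fin n) (Fin n) ℚ_[p]) *ᵥ x)) ∂(glHaar p n) := by
    rw [lam, ← integral_inv_eq_self]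
    refine integral_congr_ae (Filter.Eventually.of_forall fun g => ?_)
    have hdet : ‖(↑g⁻¹ : Matrix (Fin n) (Fin n) ℚ_[p]).det‖⁻¹ =
        ‖(g : Matrix (Fin n) (Fin n) ℚ_[p]).det‖ := by
      refine inv_eq_of_mul_eq_one_left ?_
      rw [← norm_mul, ← Matrix.det_mul, ← Units.val_mul, mul_inv_cancel, Units.val_one,
        Matrix.det_one, norm_one]
    simp only [adj, inv_inv, hdet]
    ring
  rw [h1, integral_mul_eq_sum hS hcont]
  refine Finset.sum_congr rfl fun g _ => ?_
  congr 1
  rw [lam, ← integral_kInd_mul_inv, ← integral_const_mul]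
  refine integral_congr_ae (Filter.Eventually.of_forall fun k => ?_)
  by_cases hk : k ∈ maxCompact p n
  · simp [kInd_of_mem hk, Matrix.mulVec_mulVec, Matrix.det_mul,
      norm_det_of_mem_maxCompact (inv_mem hk), -Matrix.coe_units_inv]
  · simp [kInd_of_notMem hk]

/-- Averaging over `K` does not change the integral over a sphere. -/
theorem integral_pSphere_lam_kInd {F : (Fin n → ℚ_[p]) → ℂ} {j : ℤ}
    (hF : ContinuousOn F (pSphere p n j)) :
    ∫ x in pSphere p n j, lam (kInd p n) F x ∂(vecHaar p n) =
      ∫ x in pSphere p n j, F x ∂(vecHaar p n) := by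
  set G : (Fin n → ℚ_[p]) → ℂ := (pSphere p n j).indicator F with hG
  have hGc : Continuous G := by
    refine continuous_indicator (fun x hx => ?_) (by rwa [(isClopen_pSphere j).1.closure_eq])
    rw [(isClopen_pSphere j).frontier_eq] at hx
    exact hx.elim
  have hkG : ∀ g x, kInd p n g * G ((↑g⁻¹ : Matrix (Fin n) (Fin n) ℚ_[p]) *ᵥ x) =
      (pSphere p n j).indicator (fun x => kInd p n g *
        F ((↑g⁻¹ : Matrix (Fin n) (Fin n) ℚ_[p]) *ᵥ x)) x := by
    intro g x
    by_cases hg : g ∈ maxCompact p n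
    · have h1 : (↑g⁻¹ : Matrix (Fin n) (Fin n) ℚ_[p]) *ᵥ x ∈ pSphere p n j ↔
          x ∈ pSphere p n j := by
        rw [mem_pSphere, mem_pSphere, norm_mulVec_of_mem_maxCompact (inv_mem hg)]
      by_cases hx : x ∈ pSphere p n j
      · rw [Set.indicator_of_mem hx, hG, Set.indicator_of_mem (h1.2 hx)]
      · rw [Set.indicator_of_notMem hx, hG, Set.indicator_of_notMem (mt h1.1 hx), mul_zero]
    · rw [kInd_of_notMem hg]
      simp
  have hlam : lam (kInd p n) G = (pSphere p n j).indicator (lam (kInd p n) F) := by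
    ext x
    simp only [lam, hkG]
    by_cases hx : x ∈ pSphere p n j
    · simp [Set.indicator_of_mem hx, lam]
    · simp [Set.indicator_of_notMem hx]
  rw [← integral_indicator (measurableSet_pSphere j), ← integral_indicator
    (measurableSet_pSphere j), ← hlam, ← hG]
  simp only [lam]
  rw [integral_integral_swap_of_hasCompactSupport (f := fun x g => kInd p n g *
    G ((↑g⁻¹ : Matrix (Fin n) (Fin n) ℚ_[p]) *ᵥ x))]
  · have h1 : ∀ g, ∫ x, kInd p n g * G ((↑g⁻¹ : Matrix (Fin n) (Fin n) ℚ_[p]) *ᵥ x)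
        ∂(vecHaar p n) = kInd p n g * ∫ x, G x ∂(vecHaar p n) := by
      intro g
      by_cases hg : g ∈ maxCompact p n
      · rw [integral_const_mul, integral_comp_mulVec,
          norm_det_of_mem_maxCompact (inv_mem hg)]
        simp
      · simp [kInd_of_notMem hg]
    simp only [h1]
    rw [integral_mul_const, integral_kInd, one_mul]
  · refine (isLocallyConstant_kInd.continuous.comp continuous_snd).mul (hGc.comp ?_)
    exact ((Units.continuous_val.comp continuous_inv).comp continuous_snd).matrix_mulVec
      continuous_fst
  · refine HasCompactSupport.intro ((isCompact_pBall (p := p) (n := n) j).prod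
      (isCompact_maxCompact p n)) ?_
    rintro ⟨x, g⟩ hxg
    change kInd p n g * G _ = 0
    rw [hkG]
    by_cases hx : x ∈ pSphere p n j
    · rw [Set.indicator_of_mem hx, kInd_of_notMem, zero_mul]
      exact fun hg => hxg ⟨pSphere_subset_pBall j hx, hg⟩
    · exact Set.indicator_of_notMem hx _

end Hecke

/-! ### Properties of the standard character -/

section StdChar

variable {p : ℕ} [Fact p.Prime]

theorem stdChar_add (x y : ℚ_[p]) : stdChar p (x + y) = stdChar p x * stdChar p y := by
  obtain ⟨⟨⟨m, k, hm⟩, hx⟩, ⟨m', k', hm'⟩, hy⟩ :=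
    And.intro (exists_isFractionalPart p x).choose_spec (exists_isFractionalPart p y).choose_spec
  have hp : (p : ℚ) ≠ 0 := by exact_mod_cast (Fact.out : p.Prime).ne_zero
  rw [stdChar_eq p (x + y) (fractionalPart p x + fractionalPart p y) ⟨⟨m * p ^ k' + m' * p ^ k,
    k + k', ?_⟩, ?_⟩]
  · rw [stdChar, stdChar, ← Circle.exp_add]
    push_cast
    ring_nf
  · change (exists_isFractionalPart p x).choose + (exists_isFractionalPart p y).choose = _
    rw [hm, hm', pow_add]
    push_cast
    field_simp
  · have : ((fractionalPart p x + fractionalPart p y : ℚ) : ℚ_[p]) - (x + y) =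
        ((fractionalPart p x : ℚ_[p]) - x) + ((fractionalPart p y : ℚ_[p]) - y) := by
      push_cast; ring
    rw [this]
    exact (Padic.nonarchimedean _ _).trans (max_le hx hy)

theorem stdChar_of_norm_le_one {x : ℚ_[p]} (hx : ‖x‖ ≤ 1) : stdChar p x = 1 := by
  rw [stdChar_eq p x 0 ⟨⟨0, 0, by simp⟩, by simpa using hx⟩]
  simp

theorem stdChar_inv_p_ne_one : stdChar p ((p : ℚ_[p])⁻¹) ≠ 1 := by
  rw [stdChar_eq p _ ((p : ℚ)⁻¹) ⟨⟨1, 1, by simp⟩, by simp⟩, ← Circle.exp_zero, Ne,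
    Circle.exp_eq_exp]
  rintro ⟨m, hm⟩
  have h1 : ((p : ℝ))⁻¹ = m := by
    have : (2 * Real.pi) * ((p : ℝ))⁻¹ = (2 * Real.pi) * m := by
      push_cast at hm
      linarith
    exact mul_left_cancel₀ (by positivity) this
  have h2 : (0 : ℝ) < (p : ℝ)⁻¹ := inv_pos.2 (p_pos p)
  have h3 : ((p : ℝ))⁻¹ < 1 := inv_lt_one_of_one_lt₀ (one_lt_p p)
  rw [h1] at h2 h3
  have h4 : 0 < m := by exact_mod_cast h2
  have h5 : m < 1 := by exact_mod_cast h3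
  omega

theorem continuous_stdChar : Continuous (stdChar p) := by
  refine IsLocallyConstant.continuous ((IsLocallyConstant.iff_exists_open _).2 fun x => ?_)
  refine ⟨Metric.ball x 1, Metric.isOpen_ball, Metric.mem_ball_self one_pos, fun y hy => ?_⟩
  have h : y = x + (y - x) := by ring
  have h1 : ‖y - x‖ ≤ 1 := by
    rw [← dist_eq_norm]
    exact (Metric.mem_ball.1 hy).le
  rw [h, stdChar_add, stdChar_of_norm_le_one h1, mul_one]

end StdChar

/-! ### Integrals of a second degree character over balls -/

section BallIntegrals

variable {p : ℕ} [Fact p.Prime] {n : ℕ}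

theorem norm_dotProduct_le (x y : Fin n → ℚ_[p]) : ‖x ⬝ᵥ y‖ ≤ ‖x‖ * ‖y‖ := by
  rw [dotProduct]
  refine IsUltrametricDist.norm_sum_le_of_forall_le_of_nonneg (by positivity) fun j _ => ?_
  rw [norm_mul]
  exact mul_le_mul (norm_le_pi_norm x j) (norm_le_pi_norm y j) (norm_nonneg _) (norm_nonneg _)

theorem setIntegral_add_right {S : Set (Fin n → ℚ_[p])} (hS : MeasurableSet S)
    {y : Fin n → ℚ_[p]} (hy : ∀ x, x + y ∈ S ↔ x ∈ S) (F : (Fin n → ℚ_[p]) → ℂ) :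
    ∫ x in S, F (x + y) ∂(vecHaar p n) = ∫ x in S, F x ∂(vecHaar p n) := by
  rw [← integral_indicator hS, ← integral_indicator hS,
    ← integral_add_right_eq_self (S.indicator F) y]
  refine integral_congr_ae (Filter.Eventually.of_forall fun x => ?_)
  by_cases hx : x ∈ S
  · simp [Set.indicator_of_mem hx, Set.indicator_of_mem ((hy x).2 hx)]
  · simp [Set.indicator_of_notMem hx, Set.indicator_of_notMem (mt (hy x).1 hx)]

theorem setIntegral_swap {S T : Set (Fin n → ℚ_[p])} (hS : IsCompact S) (hT : IsCompact T)
    {H : (Fin n → ℚ_[p]) → (Fin n → ℚ_[p]) → ℂ} (hH : Continuous (Function.uncurry H))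
    (hb : ∀ x y, ‖H x y‖ ≤ 1) :
    ∫ x in S, ∫ y in T, H x y ∂(vecHaar p n) ∂(vecHaar p n) =
      ∫ y in T, ∫ x in S, H x y ∂(vecHaar p n) ∂(vecHaar p n) := by
  have h1 : IsFiniteMeasure ((vecHaar p n).restrict S) := ⟨by simpa using hS.measure_lt_top⟩
  have h2 : IsFiniteMeasure ((vecHaar p n).restrict T) := ⟨by simpa using hT.measure_lt_top⟩
  refine integral_integral_swap (Integrable.of_bound hH.aestronglyMeasurable 1 ?_)
  exact Filter.Eventually.of_forall fun z => hb z.1 z.2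

variable {f : SecondDegreeCharacter (Fin n → ℚ_[p])} {α : ℚ_[p]} {a : ℤ}

theorem IsDilation.toFun_add (hα : IsDilation f α) (x y : Fin n → ℚ_[p]) :
    f.toFun (x + y) = f.toFun x * f.toFun y * stdChar p (x ⬝ᵥ (α • y)) := by
  rw [← hα x y]
  change _ = _ * (f.toFun (x + y) * (f.toFun x)⁻¹ * (f.toFun y)⁻¹)
  rw [mul_comm (f.toFun (x + y)), mul_comm _ (f.toFun y)⁻¹, ← mul_assoc, ← mul_assoc,
    mul_inv_cancel_right, mul_inv_cancel, one_mul]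

theorem IsDilation.toFun_zero (hα : IsDilation f α) : f.toFun 0 = 1 := by
  have h := hα.toFun_add 0 0
  rw [add_zero, zero_dotProduct, stdChar_of_norm_le_one (by simp), mul_one] at h
  exact left_eq_mul.1 h

theorem IsDilation.ne_zero (hα : IsDilation f α) (hn : 1 ≤ n) (hf : f.IsNondegenerate) :
    α ≠ 0 := by
  rintro rfl
  obtain ⟨x, hx⟩ := pSphere_nonempty (p := p) hn 0
  have h : f.assocHom (Multiplicative.ofAdd x) = f.assocHom (Multiplicative.ofAdd 0) := by
    refine ContinuousMonoidHom.ext fun y => ?_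
    have h1 := hα y.toAdd x
    have h2 := hα y.toAdd 0
    simp only [zero_smul] at h1 h2
    exact h1.trans h2.symm
  have h0 : x = 0 := hf.injective h
  exact zero_notMem_pSphere 0 (h0 ▸ hx)

theorem norm_dotProduct_smul_le (ha : ‖α‖ = (p : ℝ) ^ a) {j k : ℤ} (hjk : j + k + a ≤ 0)
    {x y : Fin n → ℚ_[p]} (hx : x ∈ pBall p n j) (hy : y ∈ pBall p n k) :
    ‖x ⬝ᵥ (α • y)‖ ≤ 1 := by
  refine (norm_dotProduct_le _ _).trans ?_
  rw [norm_smul, ha]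
  calc ‖x‖ * ((p : ℝ) ^ a * ‖y‖) ≤ (p : ℝ) ^ j * ((p : ℝ) ^ a * (p : ℝ) ^ k) :=
        mul_le_mul hx (mul_le_mul_of_nonneg_left hy (zpow_p_pos a).le)
          (mul_nonneg (zpow_p_pos a).le (norm_nonneg _)) (zpow_p_pos j).le
    _ = (p : ℝ) ^ (j + k + a) := by
        rw [← zpow_add₀ (p_pos p).ne', ← zpow_add₀ (p_pos p).ne']
        congr 1
        ring
    _ ≤ 1 := by rwa [← zpow_zero (p : ℝ), zpow_p_le]

theorem IsDilation.toFun_add_of_mem (hα : IsDilation f α) (ha : ‖α‖ = (p : ℝ) ^ a) {j k : ℤ}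
    (hjk : j + k + a ≤ 0) {x y : Fin n → ℚ_[p]} (hx : x ∈ pBall p n j) (hy : y ∈ pBall p n k) :
    f.toFun (x + y) = f.toFun x * f.toFun y := by
  rw [hα.toFun_add, stdChar_of_norm_le_one (norm_dotProduct_smul_le ha hjk hx hy), mul_one]

/-- Orthogonality: the character `y ↦ ψ(α x · y)` of the ball of radius `p ^ m` has integral zero
unless it is trivial. -/
theorem integral_pBall_stdChar_eq_zero (ha : ‖α‖ = (p : ℝ) ^ a) (hn : 1 ≤ n) {m : ℤ}
    {x : Fin n → ℚ_[p]} (hx : x ∉ pBall p n (-a - m)) :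
    ∫ y in pBall p n m, (stdChar p (x ⬝ᵥ (α • y)) : ℂ) ∂(vecHaar p n) = 0 := by
  have hx0 : x ≠ 0 := by rintro rfl; exact hx (zero_mem_pBall _)
  obtain ⟨k, hk⟩ := exists_norm_eq_zpow hx0
  rw [mem_pBall, hk, zpow_p_le, not_le] at hx
  obtain ⟨i, hi⟩ := exists_norm_apply_eq hn x
  have hxi : x i ≠ 0 := norm_ne_zero_iff.1 (by rw [hi, hk]; exact (zpow_p_pos k).ne')
  have hα0 : α ≠ 0 := norm_ne_zero_iff.1 (by rw [ha]; exact (zpow_p_pos a).ne')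
  -- a vector `y` of the ball with `α x · y = 1 / p`
  set y : Fin n → ℚ_[p] := Pi.single i ((p : ℚ_[p])⁻¹ * (α * x i)⁻¹) with hy
  have hym : y ∈ pBall p n m := by
    rw [mem_pBall, hy, Pi.norm_single, norm_mul, norm_inv, norm_inv, norm_mul, ha, hi, hk,
      Padic.norm_p, inv_inv, ← zpow_add₀ (p_pos p).ne', ← zpow_neg, ← zpow_one_add₀ (p_pos p).ne',
      zpow_p_le]
    omega
  have hxy : x ⬝ᵥ (α • y) = (p : ℚ_[p])⁻¹ := by
    rw [dotProduct_smul, hy, dotProduct_single, smul_eq_mul]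
    field_simp
  have h1 := setIntegral_add_right (measurableSet_pBall m)
    (fun z => add_mem_pBall_iff (x := z) hym) (fun y => (stdChar p (x ⬝ᵥ (α • y)) : ℂ))
  simp only [smul_add, dotProduct_add, hxy, stdChar_add, Circle.coe_mul] at h1
  rw [integral_mul_const] at h1
  have h2 : ((stdChar p (p : ℚ_[p])⁻¹ : Circle) : ℂ) ≠ 1 := by
    rw [← Circle.coe_one, Ne, Circle.coe_inj]
    exact stdChar_inv_p_ne_one
  exact eq_zero_of_mul_eq_self_right h2 h1

/-- For `y` in a ball whose translations act on `f` by the scalar `f y`, translation by `y` shows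
that the integral is equal to its product with `f y`. -/
theorem IsDilation.integral_pBall_eq_zero (hα : IsDilation f α) (ha : ‖α‖ = (p : ℝ) ^ a)
    {m k : ℤ} (hmk : m ≤ k) (h0 : m + k + a ≤ 0) {y : Fin n → ℚ_[p]} (hy : y ∈ pBall p n m)
    (hfy : f.toFun y ≠ 1) : ∫ x in pBall p n k, (f.toFun x : ℂ) ∂(vecHaar p n) = 0 := by
  have h1 := setIntegral_add_right (measurableSet_pBall k)
    (fun z => add_mem_pBall_iff (x := z) (pBall_mono hmk hy)) (fun x => (f.toFun x : ℂ))
  have h2 : ∀ x ∈ pBall p n k, (f.toFun (x + y) : ℂ) = f.toFun x * f.toFun y := fun x hx => by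
    rw [hα.toFun_add_of_mem ha (by omega) hx hy, Circle.coe_mul]
  rw [setIntegral_congr_fun (measurableSet_pBall k) h2, integral_mul_const] at h1
  refine eq_zero_of_mul_eq_self_right ?_ h1
  rwa [← Circle.coe_one, Ne, Circle.coe_inj]

theorem continuous_toFun_coe (f : SecondDegreeCharacter (Fin n → ℚ_[p])) :
    Continuous fun x => (f.toFun x : ℂ) :=
  continuous_subtype_val.comp f.continuous_toFun

theorem continuous_toFun_mul_stdChar (f : SecondDegreeCharacter (Fin n → ℚ_[p])) (α : ℚ_[p]) :
    Continuous (Function.uncurry fun y x : Fin n → ℚ_[p] =>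
      (f.toFun x : ℂ) * (stdChar p (x ⬝ᵥ (α • y)) : ℂ)) := by
  have h : Continuous fun z : (Fin n → ℚ_[p]) × (Fin n → ℚ_[p]) => z.2 ⬝ᵥ (α • z.1) :=
    continuous_snd.dotProduct (continuous_fst.const_smul α)
  have h1 : Continuous fun z : (Fin n → ℚ_[p]) × (Fin n → ℚ_[p]) =>
      (stdChar p (z.2 ⬝ᵥ (α • z.1)) : ℂ) :=
    continuous_subtype_val.comp (continuous_stdChar.comp h)
  exact ((continuous_toFun_coe f).comp continuous_snd).mul h1

/-- Averaging over the translations by the ball of radius `p ^ (-a - k)`, on which `f` is trivial,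
produces the integral of the character `y ↦ ψ(α x · y)`, which is nontrivial on that ball when
`‖x‖ = p ^ (k + 1)`. -/
theorem IsDilation.integral_pSphere_eq_zero (hα : IsDilation f α) (ha : ‖α‖ = (p : ℝ) ^ a)
    (hn : 1 ≤ n) {k : ℤ} (hk : 0 ≤ 2 * k + a) (h1 : ∀ y ∈ pBall p n (-a - k), f.toFun y = 1) :
    ∫ x in pSphere p n (k + 1), (f.toFun x : ℂ) ∂(vecHaar p n) = 0 := by
  set I := ∫ x in pSphere p n (k + 1), (f.toFun x : ℂ) ∂(vecHaar p n) with hI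
  have hy : ∀ y ∈ pBall p n (-a - k), ∫ x in pSphere p n (k + 1),
      (f.toFun x : ℂ) * stdChar p (x ⬝ᵥ (α • y)) ∂(vecHaar p n) = I := by
    intro y hy
    have hyk : y ∈ pBall p n k := pBall_mono (by omega) hy
    rw [hI, ← setIntegral_add_right (y := y) (measurableSet_pSphere _) ?_
      (fun x => (f.toFun x : ℂ))]
    · refine setIntegral_congr_fun (measurableSet_pSphere _) fun x _ => ?_
      rw [hα.toFun_add, h1 y hy, mul_one, Circle.coe_mul]
    · intro x
      rw [← pBall_sdiff_pBall_sub_one, Set.mem_sdiff, Set.mem_sdiff, add_sub_cancel_right,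
        add_mem_pBall_iff hyk, add_mem_pBall_iff (pBall_mono (by omega) hyk)]
  have hsw := setIntegral_swap (isCompact_pBall (p := p) (n := n) (-a - k))
    ((isCompact_pBall (p := p) (n := n) (k + 1)).of_isClosed_subset
      (isClopen_pSphere (k + 1)).1 (pSphere_subset_pBall _))
    (H := fun y x => (f.toFun x : ℂ) * stdChar p (x ⬝ᵥ (α • y)))
    (continuous_toFun_mul_stdChar f α)
    (fun y x => by rw [norm_mul, Circle.norm_coe, Circle.norm_coe, one_mul])
  rw [setIntegral_congr_fun (measurableSet_pBall _) hy, setIntegral_const,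
    vecHaar_real_pBall] at hsw
  have h0 : ∀ x ∈ pSphere p n (k + 1), ∫ y in pBall p n (-a - k),
      (f.toFun x : ℂ) * stdChar p (x ⬝ᵥ (α • y)) ∂(vecHaar p n) = 0 := by
    intro x hx
    rw [integral_const_mul, integral_pBall_stdChar_eq_zero ha hn, mul_zero]
    rw [mem_pBall, mem_pSphere.1 hx, zpow_p_le]
    omega
  rw [setIntegral_congr_fun (measurableSet_pSphere _) h0, integral_zero, smul_eq_zero] at hsw
  exact hsw.resolve_left (zpow_p_pos _).ne'

/-- The Gauss sum computation: the square of the absolute value of the integral of `f` over a large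
ball. -/
theorem IsDilation.norm_integral_pBall_sq (hα : IsDilation f α) (ha : ‖α‖ = (p : ℝ) ^ a)
    (hn : 1 ≤ n) {k : ℤ} (hk : 0 ≤ 2 * k + a) (h1 : ∀ y ∈ pBall p n (-a - k), f.toFun y = 1) :
    ‖∫ x in pBall p n k, (f.toFun x : ℂ) ∂(vecHaar p n)‖ ^ 2 = (p : ℝ) ^ (-a * n) := by
  set B := ∫ x in pBall p n k, (f.toFun x : ℂ) ∂(vecHaar p n) with hB
  have hy : ∀ y ∈ pBall p n k, ∫ z in pBall p n k,
      (f.toFun z : ℂ) * stdChar p (z ⬝ᵥ (α • y)) ∂(vecHaar p n) =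
        B * (starRingEnd ℂ) (f.toFun y : ℂ) := by
    intro y hy
    rw [hB, ← setIntegral_add_right (y := y) (measurableSet_pBall _)
      (fun z => add_mem_pBall_iff hy) (fun x => (f.toFun x : ℂ)), ← integral_mul_const]
    refine setIntegral_congr_fun (measurableSet_pBall _) fun x _ => ?_
    rw [hα.toFun_add, Circle.coe_mul, Circle.coe_mul]
    have : (f.toFun y : ℂ) * (starRingEnd ℂ) (f.toFun y : ℂ) = 1 := by
      rw [Complex.mul_conj, Circle.normSq_coe, Complex.ofReal_one]
    linear_combination (-(f.toFun x : ℂ) * (stdChar p (x ⬝ᵥ (α • y)) : ℂ)) * this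
  have hsw := setIntegral_swap (isCompact_pBall (p := p) (n := n) k)
    (isCompact_pBall (p := p) (n := n) k)
    (H := fun y z => (f.toFun z : ℂ) * stdChar p (z ⬝ᵥ (α • y)))
    (continuous_toFun_mul_stdChar f α)
    (fun y x => by rw [norm_mul, Circle.norm_coe, Circle.norm_coe, one_mul])
  have h2 : ∀ z ∈ pBall p n k, ∫ y in pBall p n k,
      (f.toFun z : ℂ) * stdChar p (z ⬝ᵥ (α • y)) ∂(vecHaar p n) =
        (pBall p n (-a - k)).indicator (fun _ => (((p : ℝ) ^ (k * n) : ℝ) : ℂ)) z := by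
    intro z hz
    rw [integral_const_mul]
    by_cases hz' : z ∈ pBall p n (-a - k)
    · rw [Set.indicator_of_mem hz', h1 z hz']
      have h3 : ∀ y ∈ pBall p n k, (stdChar p (z ⬝ᵥ (α • y)) : ℂ) = 1 := fun y hy => by
        rw [stdChar_of_norm_le_one (norm_dotProduct_smul_le ha (by omega) hz' hy), Circle.coe_one]
      rw [setIntegral_congr_fun (measurableSet_pBall _) h3, setIntegral_const, vecHaar_real_pBall]
      simp
    · rw [integral_pBall_stdChar_eq_zero ha hn hz', mul_zero, Set.indicator_of_notMem hz']
  rw [setIntegral_congr_fun (measurableSet_pBall _) hy, setIntegral_congr_fun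
    (measurableSet_pBall _) h2, integral_const_mul, integral_conj, ← hB, Complex.mul_conj,
    setIntegral_indicator (measurableSet_pBall _), Set.inter_eq_self_of_subset_right
    (pBall_mono (by omega)), setIntegral_const, vecHaar_real_pBall, Complex.real_smul,
    ← Complex.ofReal_mul, ← zpow_add₀ (p_pos p).ne', Complex.normSq_eq_norm_sq] at hsw
  have h4 := Complex.ofReal_injective hsw
  rw [h4]
  congr 1
  ring

/-- On a small ball `f` is a character close to `1`, so its integral is not zero and it is
trivial. -/
theorem IsDilation.exists_pBall_eq_one (hα : IsDilation f α) (ha : ‖α‖ = (p : ℝ) ^ a) :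
    ∃ k : ℤ, 2 * k + a ≤ 0 ∧ ∀ x ∈ pBall p n k, f.toFun x = 1 := by
  have hc := (continuous_toFun_coe f).continuousAt (x := 0)
  obtain ⟨ε, hε, hball⟩ := Metric.continuousAt_iff.1 hc (1 / 2) (by norm_num)
  obtain ⟨N, hN⟩ := exists_pow_lt_of_lt_one hε (inv_lt_one_of_one_lt₀ (one_lt_p p))
  have hk : ∃ k : ℤ, 2 * k + a ≤ 0 ∧ k ≤ -N := ⟨min (-N) (-|a|), by
    have := le_abs_self a; have := abs_nonneg a; omega, min_le_left _ _⟩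
  obtain ⟨k, hka, hkN⟩ := hk
  refine ⟨k, hka, ?_⟩
  by_contra! hne
  obtain ⟨y, hy, hfy⟩ := hne
  have h0 := hα.integral_pBall_eq_zero ha le_rfl (by omega) hy hfy
  have h1 : ∀ x ∈ pBall p n k, ‖(f.toFun x : ℂ) - 1‖ ≤ 1 / 2 := fun x hx => by
    have h2 : dist x 0 < ε := by
      rw [dist_zero_right]
      refine lt_of_le_of_lt (hx.trans (zpow_p_le.2 hkN)) ?_
      rwa [zpow_neg, zpow_natCast, ← inv_pow]
    have := hball h2
    rw [hα.toFun_zero, dist_eq_norm, Circle.coe_one] at this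
    exact this.le
  have h2 := norm_setIntegral_le_of_norm_le_const
    ((isCompact_pBall (p := p) (n := n) k).measure_lt_top (μ := vecHaar p n)) h1
  have hint : IntegrableOn (fun x => (f.toFun x : ℂ)) (pBall p n k) (vecHaar p n) :=
    (continuous_toFun_coe f).continuousOn.integrableOn_compact (isCompact_pBall k)
  rw [integral_sub hint (integrableOn_const (isCompact_pBall k).measure_lt_top.ne), h0,
    setIntegral_const, vecHaar_real_pBall, zero_sub, norm_neg, norm_smul, norm_one, mul_one,
    Real.norm_of_nonneg (zpow_p_pos _).le] at h2
  have := zpow_p_pos (p := p) (k * n)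
  linarith

/-- The integrals of `f` over the balls of radius `p ^ k`. For small radii `f` is trivial on
the ball. There is then a range of radii where the integral vanishes. For large radii the integral
is a constant `C`, whose absolute value is given by the Gauss sum computation. The two bounds `k₀`
and `k₁` are exchanged by the duality of lattices that is induced by the bicharacter of `f`. -/
theorem IsDilation.exists_integral_pBall (hα : IsDilation f α) (hα0 : α ≠ 0) (hn : 1 ≤ n) :
    ∃ (k₀ k₁ : ℤ) (C : ℂ), k₀ ≤ k₁ ∧ (∀ x ∈ pBall p n k₀, f.toFun x = 1) ∧
      (∀ k, k₀ < k → k < k₁ → ∫ x in pBall p n k, (f.toFun x : ℂ) ∂(vecHaar p n) = 0) ∧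
      (∀ k, k₁ ≤ k → ∫ x in pBall p n k, (f.toFun x : ℂ) ∂(vecHaar p n) = C) ∧
      ‖C‖ ^ 2 = (p : ℝ) ^ ((k₀ + k₁) * n) := by
  obtain ⟨a, ha⟩ := exists_norm_eq_zpow_padic hα0
  obtain ⟨k₀, ⟨hk₀, h1⟩, hmax⟩ := Int.exists_greatest_of_bdd
    (P := fun k => 2 * k + a ≤ 0 ∧ ∀ x ∈ pBall p n k, f.toFun x = 1)
    ⟨|a|, fun z hz => by have := neg_abs_le a; have := abs_nonneg a; omega⟩
    (hα.exists_pBall_eq_one ha)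
  have hne : ∀ k, k₀ < k → 2 * k + a ≤ 0 → ∃ y ∈ pBall p n k, f.toFun y ≠ 1 := by
    intro k hk hka
    by_contra! h
    exact absurd (hmax k ⟨hka, h⟩) (by omega)
  refine ⟨k₀, -a - k₀, ∫ x in pBall p n (-a - k₀), (f.toFun x : ℂ) ∂(vecHaar p n), by omega, h1,
    fun k h h' => ?_, fun k hk => ?_, ?_⟩
  · rcases le_or_gt (2 * k + a) 0 with hka | hka
    · obtain ⟨y, hy, hfy⟩ := hne k h hka
      exact hα.integral_pBall_eq_zero ha le_rfl (by omega) hy hfy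
    · obtain ⟨y, hy, hfy⟩ := hne (-a - k) (by omega) (by omega)
      exact hα.integral_pBall_eq_zero ha (by omega) (by omega) hy hfy
  · induction k, hk using Int.leInduction with
    | base => rfl
    | succ k hk ih =>
      rw [← ih]
      have h2 := hα.integral_pSphere_eq_zero ha hn (k := k) (by omega)
        fun y hy => h1 y (pBall_mono (by omega) hy)
      rw [← pBall_sdiff_pBall_sub_one, add_sub_cancel_right,
        setIntegral_sdiff (measurableSet_pBall _)
        ((continuous_toFun_coe f).continuousOn.integrableOn_compact (isCompact_pBall _))
        (pBall_mono (by omega)), sub_eq_zero] at h2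
      exact h2
  · rw [hα.norm_integral_pBall_sq ha hn (by omega) fun y hy => h1 y (pBall_mono (by omega) hy)]
    congr 1
    ring

end BallIntegrals

/-! ### The weak Mellin transform as the Mellin transform of the average over `K` -/

section Average

variable {p : ℕ} [Fact p.Prime] {n : ℕ} {F : (Fin n → ℚ_[p]) → ℂ}

theorem norm_lam_kInd_le (hF : ∀ x, ‖F x‖ ≤ 1) (v : Fin n → ℚ_[p]) :
    ‖lam (kInd p n) F v‖ ≤ 1 := by
  have h := norm_integral_le_of_norm_le
    (f := fun g => kInd p n g * F ((↑g⁻¹ : Matrix (Fin n) (Fin n) ℚ_[p]) *ᵥ v))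
    (g := (maxCompact p n : Set (GL (Fin n) ℚ_[p])).indicator fun _ => (1 : ℝ)) (μ := glHaar p n)
    ((integrableOn_const (isCompact_maxCompact p n).measure_lt_top.ne).integrable_indicator
      measurableSet_maxCompact)
    (Filter.Eventually.of_forall fun g => ?_)
  · refine h.trans ?_
    rw [integral_indicator measurableSet_maxCompact]
    simp [measureReal_def, glHaar_maxCompact]
  · by_cases hg : g ∈ maxCompact p n
    · rw [kInd_of_mem hg, one_mul, Set.indicator_of_mem hg]
      exact hF _
    · rw [kInd_of_notMem hg, zero_mul, Set.indicator_of_notMem hg, norm_zero]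

theorem lam_kInd_of_mem_pBall {k₀ : ℤ} (h1 : ∀ x ∈ pBall p n k₀, F x = 1) {v : Fin n → ℚ_[p]}
    (hv : v ∈ pBall p n k₀) : lam (kInd p n) F v = 1 := by
  rw [lam, ← integral_kInd (p := p) (n := n)]
  refine integral_congr_ae (Filter.Eventually.of_forall fun g => ?_)
  by_cases hg : g ∈ maxCompact p n
  · have : (↑g⁻¹ : Matrix (Fin n) (Fin n) ℚ_[p]) *ᵥ v ∈ pBall p n k₀ := by
      rwa [mem_pBall, norm_mulVec_of_mem_maxCompact (inv_mem hg)]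
    simp only [h1 _ this, mul_one]
  · simp [kInd_of_notMem hg]

theorem lam_kInd_eq_of_norm_eq (F : (Fin n → ℚ_[p]) → ℂ) {v w : Fin n → ℚ_[p]} (h : ‖v‖ = ‖w‖) :
    lam (kInd p n) F v = lam (kInd p n) F w :=
  lam_eq_of_norm_eq isHecke_kInd.left_invariant F h

theorem lam_kInd_mul_vecHaar (hF : Continuous F) {j : ℤ} {v : Fin n → ℚ_[p]}
    (hv : v ∈ pSphere p n j) : lam (kInd p n) F v * (vecHaar p n).real (pSphere p n j) =
      ∫ x in pSphere p n j, F x ∂(vecHaar p n) := by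
  rw [← integral_pSphere_lam_kInd hF.continuousOn, setIntegral_congr_fun (measurableSet_pSphere j)
    (fun x hx => lam_kInd_eq_of_norm_eq F ((mem_pSphere.1 hx).trans (mem_pSphere.1 hv).symm)),
    setIntegral_const, Complex.real_smul, mul_comm]

theorem continuous_lam_kInd {k₀ : ℤ} (h1 : ∀ x ∈ pBall p n k₀, F x = 1) :
    Continuous (lam (kInd p n) F) := by
  refine IsLocallyConstant.continuous ((IsLocallyConstant.iff_exists_open _).2 fun x => ?_)
  rcases eq_or_ne x 0 with rfl | hx
  · refine ⟨pBall p n k₀, isOpen_pBall k₀, zero_mem_pBall k₀, fun y hy => ?_⟩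
    rw [lam_kInd_of_mem_pBall h1 hy, lam_kInd_of_mem_pBall h1 (zero_mem_pBall k₀)]
  · obtain ⟨j, hj⟩ := exists_norm_eq_zpow hx
    exact ⟨pSphere p n j, (isClopen_pSphere j).2, hj, fun y hy =>
      lam_kInd_eq_of_norm_eq F ((mem_pSphere.1 hy).trans hj.symm)⟩

theorem lam_kInd_eq_zero (hn : 1 ≤ n) (hF : Continuous F) {k₁ : ℤ}
    (h0 : ∀ k, k₁ < k → ∫ x in pSphere p n k, F x ∂(vecHaar p n) = 0) {v : Fin n → ℚ_[p]}
    (hv : v ∉ pBall p n k₁) : lam (kInd p n) F v = 0 := by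
  have hv0 : v ≠ 0 := by rintro rfl; exact hv (zero_mem_pBall _)
  obtain ⟨j, hj⟩ := exists_norm_eq_zpow hv0
  rw [mem_pBall, hj, zpow_p_le, not_le] at hv
  have h := lam_kInd_mul_vecHaar hF (mem_pSphere.2 hj)
  rw [h0 j hv, mul_eq_zero] at h
  exact h.resolve_right (by exact_mod_cast (vecHaar_real_pSphere_pos hn j).ne')

theorem integrable_mul_normPow (hn : 1 ≤ n) {G : (Fin n → ℚ_[p]) → ℂ} (hG : Continuous G)
    (hb : ∀ x, ‖G x‖ ≤ 1) {M : ℤ} (hM : ∀ x, x ∉ pBall p n M → G x = 0) {s : ℂ}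
    (hs : 0 < s.re) : Integrable (fun x => G x * normPow (s - n) x) (vecHaar p n) := by
  rw [← integrableOn_iff_integrable_of_support_subset (s := pBall p n M)]
  · exact (integrableOn_pBall_normPow hn M hs).bdd_mul hG.aestronglyMeasurable
      (Filter.Eventually.of_forall hb)
  · intro x hx
    by_contra h
    exact hx (by simp [hM x h])

theorem integrable_comp_mulVec {G : (Fin n → ℚ_[p]) → ℂ} (hG : Integrable G (vecHaar p n))
    (g : GL (Fin n) ℚ_[p]) :
    Integrable (fun x => G ((g : Matrix (Fin n) (Fin n) ℚ_[p]) *ᵥ x)) (vecHaar p n) := by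
  refine ((mulVecHomeo g).isClosedEmbedding.measurableEmbedding.integrable_map_iff
    (μ := vecHaar p n) (g := G)).1 ?_
  change Integrable G (Measure.map (fun x => (g : Matrix (Fin n) (Fin n) ℚ_[p]) *ᵥ x)
    (vecHaar p n))
  rw [map_mulVec_vecHaar]
  exact hG.smul_measure_nnreal

theorem integral_mul_normPow_comp_inv (g : GL (Fin n) ℚ_[p]) (G : (Fin n → ℚ_[p]) → ℂ) (t : ℂ) :
    ∫ x, G ((↑g⁻¹ : Matrix (Fin n) (Fin n) ℚ_[p]) *ᵥ x) * normPow t x ∂(vecHaar p n) =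
      (‖(g : Matrix (Fin n) (Fin n) ℚ_[p]).det‖ : ℂ) *
        ∫ x, G x * normPow t ((g : Matrix (Fin n) (Fin n) ℚ_[p]) *ᵥ x) ∂(vecHaar p n) := by
  have h := integral_comp_mulVec g
    (fun x => G ((↑g⁻¹ : Matrix (Fin n) (Fin n) ℚ_[p]) *ᵥ x) * normPow t x)
  simp only [inv_mulVec_mulVec] at h
  rw [h, ← mul_assoc, ← Complex.ofReal_mul, mul_inv_cancel₀ (norm_det_pos g).ne',
    Complex.ofReal_one, one_mul]

theorem integral_pSphere_normPow_mulVec (g : GL (Fin n) ℚ_[p]) (t : ℂ) {j : ℤ}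
    {e : Fin n → ℚ_[p]} (he : e ∈ pSphere p n j) :
    ∫ x in pSphere p n j, normPow t ((g : Matrix (Fin n) (Fin n) ℚ_[p]) *ᵥ x) ∂(vecHaar p n) =
      (vecHaar p n).real (pSphere p n j) *
        lam (kInd p n) (fun y => normPow t ((g : Matrix (Fin n) (Fin n) ℚ_[p]) *ᵥ y)) e := by
  rw [← integral_pSphere_lam_kInd, setIntegral_congr_fun (measurableSet_pSphere j)
    (fun x hx => lam_kInd_eq_of_norm_eq _ ((mem_pSphere.1 hx).trans (mem_pSphere.1 he).symm)),
    setIntegral_const, Complex.real_smul]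
  intro x hx
  have hx0 : x ≠ 0 := by rintro rfl; exact zero_notMem_pSphere j hx
  exact (ContinuousAt.comp (f := fun x => (g : Matrix (Fin n) (Fin n) ℚ_[p]) *ᵥ x)
    (continuousAt_normPow t (mulVec_ne_zero g hx0))
    (continuous_mulVec g).continuousAt).continuousWithinAt

/-- If the average of `F` over `K` is trivial near zero and has compact support, then the weak
Mellin transform of `F` is the Mellin transform of this average. The change of variables `x ↦ g x`
moves the Hecke operator to the function `‖x‖ ^ (s - n)`, and the average, being constant on
spheres, only sees the integrals over spheres. -/
theorem mellin_lam (hn : 1 ≤ n) (hF : Continuous F) (hb : ∀ x, ‖F x‖ ≤ 1) {k₀ k₁ : ℤ}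
    (h1 : ∀ x ∈ pBall p n k₀, F x = 1)
    (h0 : ∀ k, k₁ < k → ∫ x in pSphere p n k, F x ∂(vecHaar p n) = 0) {s : ℂ} (hs : 0 < s.re)
    {φ : GL (Fin n) ℚ_[p] → ℂ} (hφ : IsHecke φ) :
    MellinConverges (lam φ F) s ∧ ∀ ξ, IsXi (adj φ) (s - n) ξ →
      mellinVec (lam φ F) s = ξ * mellinVec (lam (kInd p n) F) s := by
  obtain ⟨S, hS⟩ := hφ.exists_finset
  have hcont := continuous_lam_kInd h1
  have hbd := norm_lam_kInd_le hb
  have hint : ∀ g : GL (Fin n) ℚ_[p], Integrable (fun x =>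
      lam (kInd p n) F ((↑g⁻¹ : Matrix (Fin n) (Fin n) ℚ_[p]) *ᵥ x) * normPow (s - n) x)
      (vecHaar p n) := by
    intro g
    obtain ⟨m, hm⟩ := exists_norm_mulVec_le (g : Matrix (Fin n) (Fin n) ℚ_[p])
    refine integrable_mul_normPow hn (M := m + k₁) (hcont.comp (continuous_mulVec g⁻¹))
      (fun x => hbd _) (fun x hx => lam_kInd_eq_zero hn hF h0 fun h => hx ?_) hs
    rw [← mulVec_inv_mulVec g x, mem_pBall, zpow_add₀ (p_pos p).ne']
    exact (hm _).trans (mul_le_mul_of_nonneg_left h (zpow_p_pos m).le)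
  have hlam : ∀ x, lam φ F x * normPow (s - n) x = ∑ g ∈ S, φ g *
      (lam (kInd p n) F ((↑g⁻¹ : Matrix (Fin n) (Fin n) ℚ_[p]) *ᵥ x) * normPow (s - n) x) := by
    intro x
    rw [lam_eq_sum hS hF, Finset.sum_mul]
    exact Finset.sum_congr rfl fun g _ => mul_assoc _ _ _
  have hint1 : Integrable (fun x => lam (kInd p n) F x * normPow (s - n) x) (vecHaar p n) := by
    simpa using hint 1
  refine ⟨?_, fun ξ hξ => ?_⟩
  · unfold MellinConverges
    simp only [hlam]
    exact integrable_finsetSum _ fun g _ => (hint g).const_mul _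
  have hint2 : ∀ g : GL (Fin n) ℚ_[p], Integrable (fun x => lam (kInd p n) F x *
      normPow (s - n) ((g : Matrix (Fin n) (Fin n) ℚ_[p]) *ᵥ x)) (vecHaar p n) := by
    intro g
    have := integrable_comp_mulVec (hint g) g
    simpa only [inv_mulVec_mulVec] using this
  have hsum : mellinVec (lam φ F) s = ∑ g ∈ S, φ g *
      ((‖(g : Matrix (Fin n) (Fin n) ℚ_[p]).det‖ : ℂ) * ∫ x, lam (kInd p n) F x *
        normPow (s - n) ((g : Matrix (Fin n) (Fin n) ℚ_[p]) *ᵥ x) ∂(vecHaar p n)) := by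
    rw [mellinVec]
    simp only [hlam]
    rw [integral_finsetSum _ fun g _ => (hint g).const_mul _]
    refine Finset.sum_congr rfl fun g _ => ?_
    rw [integral_const_mul, integral_mul_normPow_comp_inv]
  have hint3 : ∀ g : GL (Fin n) ℚ_[p], Integrable (fun x => φ g *
      ((‖(g : Matrix (Fin n) (Fin n) ℚ_[p]).det‖ : ℂ) * (lam (kInd p n) F x *
        normPow (s - n) ((g : Matrix (Fin n) (Fin n) ℚ_[p]) *ᵥ x)))) (vecHaar p n) :=
    fun g => ((hint2 g).const_mul _).const_mul _
  -- the difference of both sides is the integral of a function with integral zero on all spheres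
  have hzero := integral_eq_zero_of_forall_pSphere hn
    ((integrable_finsetSum S fun g _ => hint3 g).sub (hint1.const_mul ξ)) (fun j => by
      obtain ⟨e, he⟩ := pSphere_nonempty (p := p) hn j
      have he0 : e ≠ 0 := by rintro rfl; exact zero_notMem_pSphere j he
      have hc : ∀ x ∈ pSphere p n j, lam (kInd p n) F x = lam (kInd p n) F e := fun x hx =>
        lam_kInd_eq_of_norm_eq F ((mem_pSphere.1 hx).trans (mem_pSphere.1 he).symm)
      simp only [Pi.sub_apply]
      rw [integral_sub (integrable_finsetSum S fun g _ => (hint3 g).integrableOn)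
        (hint1.const_mul ξ).integrableOn, integral_finsetSum _ fun g _ => (hint3 g).integrableOn]
      have ha : ∀ g ∈ S, ∫ x in pSphere p n j, φ g *
          ((‖(g : Matrix (Fin n) (Fin n) ℚ_[p]).det‖ : ℂ) * (lam (kInd p n) F x *
            normPow (s - n) ((g : Matrix (Fin n) (Fin n) ℚ_[p]) *ᵥ x))) ∂(vecHaar p n) =
          lam (kInd p n) F e * (vecHaar p n).real (pSphere p n j) * (φ g *
            ((‖(g : Matrix (Fin n) (Fin n) ℚ_[p]).det‖ : ℂ) * lam (kInd p n) (fun y =>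
              normPow (s - n) ((g : Matrix (Fin n) (Fin n) ℚ_[p]) *ᵥ y)) e)) := by
        intro g _
        have h2 := setIntegral_congr_fun (μ := vecHaar p n) (measurableSet_pSphere j)
          (fun x hx => congrArg (fun c => c * normPow (s - n)
            ((g : Matrix (Fin n) (Fin n) ℚ_[p]) *ᵥ x)) (hc x hx))
        rw [integral_const_mul, integral_const_mul, h2, integral_const_mul,
          integral_pSphere_normPow_mulVec g _ he]
        ring
      have hb : ∫ x in pSphere p n j, ξ * (lam (kInd p n) F x * normPow (s - n) x)
          ∂(vecHaar p n) = lam (kInd p n) F e * (vecHaar p n).real (pSphere p n j) *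
            (ξ * normPow (s - n) e) := by
        have h2 : ∀ x ∈ pSphere p n j, ξ * (lam (kInd p n) F x * normPow (s - n) x) =
            ξ * (lam (kInd p n) F e * normPow (s - n) e) := fun x hx => by
          rw [hc x hx, normPow_of_mem_pSphere hx, normPow_of_mem_pSphere he]
        rw [setIntegral_congr_fun (measurableSet_pSphere j) h2, setIntegral_const,
          Complex.real_smul]
        ring
      rw [Finset.sum_congr rfl ha, hb, ← Finset.mul_sum, ← hξ e he0,
        lam_adj_normPow_eq_sum hS (s - n) he0, sub_self])
  simp only [Pi.sub_apply] at hzero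
  rw [integral_sub (integrable_finsetSum S fun g _ => hint3 g) (hint1.const_mul ξ),
    integral_finsetSum _ fun g _ => hint3 g, sub_eq_zero, integral_const_mul] at hzero
  rw [hsum, mellinVec, ← hzero]
  refine Finset.sum_congr rfl fun g _ => ?_
  rw [integral_const_mul, integral_const_mul]

theorem isXi_adj_kInd (t : ℂ) : IsXi (adj (kInd p n)) t 1 := by
  intro x _
  rw [one_mul, lam]
  have h : ∀ g : GL (Fin n) ℚ_[p], adj (kInd p n) g *
      normPow t ((↑g⁻¹ : Matrix (Fin n) (Fin n) ℚ_[p]) *ᵥ x) = kInd p n g * normPow t x := by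
    intro g
    by_cases hg : g ∈ maxCompact p n
    · rw [adj, kInd_of_mem hg, kInd_of_mem (inv_mem hg), norm_det_of_mem_maxCompact hg, normPow,
        norm_mulVec_of_mem_maxCompact (inv_mem hg), normPow]
      simp
    · have hg' : g⁻¹ ∉ maxCompact p n := fun h => hg (by simpa using inv_mem h)
      rw [adj, kInd_of_notMem hg, kInd_of_notMem hg']
      simp
  simp only [h]
  rw [integral_mul_const, integral_kInd, one_mul]

theorem IsXi.unique (hn : 1 ≤ n) {φ : GL (Fin n) ℚ_[p] → ℂ} {t ξ ξ' : ℂ} (h : IsXi φ t ξ)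
    (h' : IsXi φ t ξ') : ξ = ξ' := by
  obtain ⟨e, he⟩ := pSphere_nonempty (p := p) hn 0
  have he0 : e ≠ 0 := by rintro rfl; exact zero_notMem_pSphere 0 he
  have h1 := (h e he0).symm.trans (h' e he0)
  refine mul_right_cancel₀ ?_ h1
  rw [normPow_of_mem_pSphere he, zpow_zero]
  exact one_ne_zero

/-- Testing against the unit of the Hecke algebra shows that a weak Mellin transform is unique. -/
theorem IsWeakMellin.eq_mellinVec (hn : 1 ≤ n) {s M : ℂ} (h : IsWeakMellin F s M) :
    M = mellinVec (lam (kInd p n) F) s := by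
  obtain ⟨-, ξ, hξ, h1⟩ := h _ isHecke_kInd
  rw [h1, hξ.unique hn (isXi_adj_kInd _), one_mul]

theorem isWeakMellin_mellinVec (hn : 1 ≤ n) (hF : Continuous F) (hb : ∀ x, ‖F x‖ ≤ 1) {k₀ k₁ : ℤ}
    (h1 : ∀ x ∈ pBall p n k₀, F x = 1)
    (h0 : ∀ k, k₁ < k → ∫ x in pSphere p n k, F x ∂(vecHaar p n) = 0) {s : ℂ} (hs : 0 < s.re) :
    IsWeakMellin F s (mellinVec (lam (kInd p n) F) s) := by
  intro φ hφ
  obtain ⟨hc, h2⟩ := mellin_lam hn hF hb h1 h0 hs hφ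
  obtain ⟨ξ, hξ⟩ := exists_isXi_adj hn hφ (s - n)
  exact ⟨hc, ξ, hξ, h2 ξ hξ⟩

theorem integral_pSphere_lam_kInd_mul_normPow (hF : Continuous F) (s : ℂ) (k : ℤ) :
    ∫ x in pSphere p n k, lam (kInd p n) F x * normPow (s - n) x ∂(vecHaar p n) =
      (∫ x in pBall p n k, F x ∂(vecHaar p n) - ∫ x in pBall p n (k - 1), F x ∂(vecHaar p n)) *
        ((p : ℂ) ^ s * ((p : ℂ) ^ n)⁻¹) ^ k := by
  have h : ∀ x ∈ pSphere p n k, lam (kInd p n) F x * normPow (s - n) x =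
      lam (kInd p n) F x * ((p : ℂ) ^ s * ((p : ℂ) ^ n)⁻¹) ^ k := fun x hx => by
    rw [normPow_of_mem_pSphere hx, Complex.cpow_sub _ _ p_ne_zero_complex, Complex.cpow_natCast,
      div_eq_mul_inv]
  rw [setIntegral_congr_fun (measurableSet_pSphere k) h, integral_mul_const,
    integral_pSphere_lam_kInd hF.continuousOn, ← setIntegral_sdiff (measurableSet_pBall _)
      (hF.continuousOn.integrableOn_compact (isCompact_pBall _)) (pBall_mono (by omega)),
    pBall_sdiff_pBall_sub_one]

/-- The Mellin transform of the average, computed by summation over spheres. -/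
theorem mellinVec_lam_kInd (hn : 1 ≤ n) (hF : Continuous F) (hb : ∀ x, ‖F x‖ ≤ 1) {k₀ k₁ : ℤ}
    {C : ℂ} (hk : k₀ ≤ k₁) (h1 : ∀ x ∈ pBall p n k₀, F x = 1)
    (hmid : ∀ k, k₀ < k → k < k₁ → ∫ x in pBall p n k, F x ∂(vecHaar p n) = 0)
    (hC : ∀ k, k₁ ≤ k → ∫ x in pBall p n k, F x ∂(vecHaar p n) = C) {s : ℂ} (hs : 0 < s.re) :
    mellinVec (lam (kInd p n) F) s =
      ((p : ℂ) ^ s) ^ k₀ * (1 - ((p : ℂ) ^ n)⁻¹) * (1 - ((p : ℂ) ^ s)⁻¹)⁻¹ +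
        if k₀ < k₁ then C * ((p : ℂ) ^ s * ((p : ℂ) ^ n)⁻¹) ^ k₁ -
          ((p : ℂ) ^ s) ^ (k₀ + 1) * ((p : ℂ) ^ n)⁻¹ else 0 := by
  have h0 : ∀ k, k₁ < k → ∫ x in pSphere p n k, F x ∂(vecHaar p n) = 0 := fun k hk => by
    rw [← pBall_sdiff_pBall_sub_one, setIntegral_sdiff (measurableSet_pBall _)
      (hF.continuousOn.integrableOn_compact (isCompact_pBall _)) (pBall_mono (by omega)),
      hC k hk.le, hC (k - 1) (by omega), sub_self]
  have hvan : ∀ x, x ∉ pBall p n k₁ → lam (kInd p n) F x = 0 := fun x hx =>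
    lam_kInd_eq_zero hn hF h0 hx
  have hint := integrable_mul_normPow hn (continuous_lam_kInd h1) (norm_lam_kInd_le hb) hvan hs
  set T : ℤ → ℂ := fun k =>
    ∫ x in pBall p n k, lam (kInd p n) F x * normPow (s - n) x ∂(vecHaar p n) with hT
  have hTk₁ : mellinVec (lam (kInd p n) F) s = T k₁ := by
    rw [hT, mellinVec]
    exact (setIntegral_eq_integral_of_forall_compl_eq_zero fun x hx => by
      rw [hvan x hx, zero_mul]).symm
  have hTk₀ : T k₀ =
      ((p : ℂ) ^ s) ^ k₀ * (1 - ((p : ℂ) ^ n)⁻¹) * (1 - ((p : ℂ) ^ s)⁻¹)⁻¹ := by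
    rw [← integral_pBall_normPow hn k₀ hs]
    refine setIntegral_congr_fun (measurableSet_pBall _) fun x hx => ?_
    simp only [lam_kInd_of_mem_pBall h1 hx, one_mul]
  have hTsucc : ∀ k, T (k + 1) = T k + (∫ x in pBall p n (k + 1), F x ∂(vecHaar p n) -
      ∫ x in pBall p n k, F x ∂(vecHaar p n)) * ((p : ℂ) ^ s * ((p : ℂ) ^ n)⁻¹) ^ (k + 1) := by
    intro k
    have h2 := integral_pSphere_lam_kInd_mul_normPow hF s (k + 1)
    rw [add_sub_cancel_right, ← pBall_sdiff_pBall_sub_one, add_sub_cancel_right,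
      setIntegral_sdiff (measurableSet_pBall _) hint.integrableOn (pBall_mono (by omega))] at h2
    rw [← h2]
    simp only [hT]
    ring
  have hBk₀ : ∫ x in pBall p n k₀, F x ∂(vecHaar p n) = ((p : ℂ) ^ n) ^ k₀ := by
    rw [setIntegral_congr_fun (measurableSet_pBall _) h1, setIntegral_const, vecHaar_real_pBall,
      Complex.real_smul, mul_one, mul_comm k₀, zpow_mul]
    push_cast
    rw [zpow_natCast]
  have hpn : ((p : ℂ) ^ n) ≠ 0 := pow_ne_zero _ p_ne_zero_complex
  have hcancel : ((p : ℂ) ^ n) ^ k₀ * ((p : ℂ) ^ s * ((p : ℂ) ^ n)⁻¹) ^ (k₀ + 1) =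
      ((p : ℂ) ^ s) ^ (k₀ + 1) * ((p : ℂ) ^ n)⁻¹ := by
    rw [mul_zpow, inv_zpow, zpow_add_one₀ hpn]
    field_simp
  -- partial sums over the spheres of radius at most `p ^ k`
  have hTk : ∀ k, k₀ + 1 ≤ k → k ≤ k₁ → T k = T k₀ - ((p : ℂ) ^ s) ^ (k₀ + 1) * ((p : ℂ) ^ n)⁻¹ +
      (∫ x in pBall p n k, F x ∂(vecHaar p n)) * ((p : ℂ) ^ s * ((p : ℂ) ^ n)⁻¹) ^ k := by
    intro k hk
    induction k, hk using Int.leInduction with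
    | base =>
      intro _
      rw [hTsucc, hBk₀, ← hcancel]
      ring
    | succ k hk ih =>
      intro hk₁
      rw [hTsucc, ih (by omega), hmid k (by omega) (by omega)]
      ring
  rw [hTk₁]
  split_ifs with hlt
  · rw [hTk k₁ (by omega) le_rfl, hTk₀, hC k₁ le_rfl]
    ring
  · rw [show k₁ = k₀ by omega, hTk₀, add_zero]

end Average

/-! ### Zeros and continuation -/

section Zeros

/-- The heart of the location of the zeros: the sign of `‖1 - ρ P‖² - ρ ‖P - 1‖²` is that of
`1 - ρ ‖P‖²`, while an equation `1 - ρ P = c P ^ m (P - 1)` with `‖c‖² = ρ ^ (m + 1)` forces the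
quotient of the two terms to be `(ρ ‖P‖²) ^ m`. -/
theorem mul_norm_sq_eq_one {ρ : ℝ} (hρ0 : 0 < ρ) (hρ1 : ρ < 1) {P c : ℂ} {m : ℕ}
    (hc : ‖c‖ ^ 2 = ρ ^ (m + 1)) (h : 1 - ρ * P = c * P ^ m * (P - 1)) : ρ * ‖P‖ ^ 2 = 1 := by
  set u := ρ * ‖P‖ ^ 2 with hu
  have hu0 : 0 ≤ u := by positivity
  have hA : ‖1 - ρ * P‖ ^ 2 = u ^ m * (ρ * ‖P - 1‖ ^ 2) := by
    rw [h, norm_mul, norm_mul, norm_pow, mul_pow, mul_pow, hc, hu]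
    ring
  have hAB : ‖1 - ρ * P‖ ^ 2 - ρ * ‖P - 1‖ ^ 2 = (1 - u) * (1 - ρ) := by
    rw [hu, ← Complex.normSq_eq_norm_sq, ← Complex.normSq_eq_norm_sq, ← Complex.normSq_eq_norm_sq]
    simp only [Complex.normSq_apply, Complex.sub_re, Complex.sub_im, Complex.one_re,
      Complex.one_im, Complex.re_ofReal_mul, Complex.im_ofReal_mul]
    ring
  have hB : 0 ≤ ρ * ‖P - 1‖ ^ 2 := by positivity
  rcases lt_trichotomy u 1 with h1 | h1 | h1
  · have h2 : u ^ m * (ρ * ‖P - 1‖ ^ 2) ≤ 1 * (ρ * ‖P - 1‖ ^ 2) :=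
      mul_le_mul_of_nonneg_right (pow_le_one₀ hu0 h1.le) hB
    have h3 : 0 < (1 - u) * (1 - ρ) := mul_pos (by linarith) (by linarith)
    linarith
  · exact h1
  · have h2 : 1 * (ρ * ‖P - 1‖ ^ 2) ≤ u ^ m * (ρ * ‖P - 1‖ ^ 2) :=
      mul_le_mul_of_nonneg_right (one_le_pow₀ h1.le) hB
    have h3 : 0 < (u - 1) * (1 - ρ) := mul_pos (by linarith) (by linarith)
    linarith

variable {p : ℕ} [Fact p.Prime] {n : ℕ}

theorem re_eq_of_mul_norm_sq_eq_one {s : ℂ}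
    (h : ((p : ℝ) ^ n)⁻¹ * ‖(p : ℂ) ^ s‖ ^ 2 = 1) : s.re = n / 2 := by
  rw [norm_p_cpow, inv_mul_eq_iff_eq_mul₀ (pow_pos (p_pos p) n).ne', mul_one,
    ← Real.rpow_natCast, ← Real.rpow_mul (p_pos p).le, ← Real.rpow_natCast,
    Real.rpow_right_inj (p_pos p) (one_lt_p p).ne'] at h
  push_cast at h
  linarith

theorem differentiable_p_cpow : Differentiable ℂ fun s : ℂ => (p : ℂ) ^ s := fun _ =>
  (differentiableAt_id).const_cpow (Or.inl p_ne_zero_complex)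

/-- The Mellin transform over the common denominator `1 - p ^ (-s)`: its numerator is entire and has
zeros only on the line `Re s = n / 2`. -/
theorem exists_numerator (hn : 1 ≤ n) {k₀ k₁ : ℤ} {C : ℂ}
    (hC : ‖C‖ ^ 2 = (p : ℝ) ^ ((k₀ + k₁) * n)) :
    ∃ N : ℂ → ℂ, Differentiable ℂ N ∧ (∀ s, N s = 0 → s.re = n / 2) ∧
      ∀ s : ℂ, 1 - ((p : ℂ) ^ s)⁻¹ ≠ 0 → N s * (1 - ((p : ℂ) ^ s)⁻¹)⁻¹ =
        ((p : ℂ) ^ s) ^ k₀ * (1 - ((p : ℂ) ^ n)⁻¹) * (1 - ((p : ℂ) ^ s)⁻¹)⁻¹ +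
        if k₀ < k₁ then C * ((p : ℂ) ^ s * ((p : ℂ) ^ n)⁻¹) ^ k₁ -
          ((p : ℂ) ^ s) ^ (k₀ + 1) * ((p : ℂ) ^ n)⁻¹ else 0 := by
  have hd := differentiable_p_cpow (p := p)
  have hdz : ∀ k : ℤ, Differentiable ℂ fun s : ℂ => ((p : ℂ) ^ s) ^ k := fun k s =>
    (hd s).zpow (Or.inl (p_cpow_ne_zero s))
  have hρ0 : (0 : ℝ) < ((p : ℝ) ^ n)⁻¹ := inv_pos.2 (pow_pos (p_pos p) n)
  have hρ1 : ((p : ℝ) ^ n)⁻¹ < 1 := inv_lt_one_of_one_lt₀ (one_lt_pow₀ (one_lt_p p) (by omega))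
  have hcast : ((((p : ℝ) ^ n)⁻¹ : ℝ) : ℂ) = ((p : ℂ) ^ n)⁻¹ := by push_cast; rfl
  split_ifs with hlt
  · refine ⟨fun s => ((p : ℂ) ^ s) ^ k₀ * (1 - ((p : ℂ) ^ n)⁻¹ * (p : ℂ) ^ s) +
      C * ((((p : ℂ) ^ s) ^ k₁) * (((p : ℂ) ^ n)⁻¹) ^ k₁) * (1 - ((p : ℂ) ^ s) ^ (-1 : ℤ)),
      ?_, fun s hs => ?_, fun s hs => ?_⟩
    · exact ((hdz k₀).mul ((differentiable_const _).sub ((differentiable_const _).mul hd))).add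
        (((differentiable_const _).mul ((hdz k₁).mul (differentiable_const _))).mul
          ((differentiable_const _).sub (hdz (-1))))
    · obtain ⟨m, hm⟩ : ∃ m : ℕ, k₁ = k₀ + m + 1 := ⟨(k₁ - k₀ - 1).toNat, by omega⟩
      refine re_eq_of_mul_norm_sq_eq_one (p := p) (mul_norm_sq_eq_one hρ0 hρ1
        (c := -C * (((p : ℂ) ^ n)⁻¹) ^ k₁) (m := m) ?_ ?_)
      · have hR : ∀ R : ℝ, 0 < R → R ^ (k₀ + k₁) * (R⁻¹ ^ k₁) ^ 2 = R⁻¹ ^ (m + 1) := fun R hR => by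
          rw [inv_zpow', ← zpow_natCast, ← zpow_natCast, inv_zpow', ← zpow_mul,
            ← zpow_add₀ hR.ne', hm]
          congr 1
          push_cast
          ring
        rw [← hR _ (pow_pos (p_pos p) n), norm_mul, norm_neg, mul_pow, hC, norm_zpow, norm_inv,
          norm_pow, Complex.norm_natCast, mul_comm _ (n : ℤ), zpow_mul, zpow_natCast]
      · have hP := p_cpow_ne_zero (p := p) s
        have hP0 : ((p : ℂ) ^ s) ^ k₀ ≠ 0 := zpow_ne_zero _ hP
        have h2 : ((p : ℂ) ^ s) ^ k₁ * (1 - ((p : ℂ) ^ s) ^ (-1 : ℤ)) =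
            ((p : ℂ) ^ s) ^ k₀ * (((p : ℂ) ^ s) ^ m * ((p : ℂ) ^ s - 1)) := by
          rw [hm, zpow_add_one₀ hP, zpow_add₀ hP, zpow_natCast, zpow_neg_one]
          field_simp
        refine mul_left_cancel₀ hP0 ?_
        rw [hcast]
        linear_combination hs - C * (((p : ℂ) ^ n)⁻¹) ^ k₁ * h2
    · have hP := p_cpow_ne_zero (p := p) s
      rw [← mul_inv_cancel_right₀ hs (C * _ - _), ← add_mul]
      congr 1
      simp only [zpow_neg_one, zpow_add_one₀ hP, mul_zpow]
      linear_combination (-(((p : ℂ) ^ s) ^ k₀ * ((p : ℂ) ^ n)⁻¹)) * mul_inv_cancel₀ hP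
  · refine ⟨fun s => ((p : ℂ) ^ s) ^ k₀ * (1 - ((p : ℂ) ^ n)⁻¹), (hdz k₀).mul_const _,
      fun s hs => ?_, fun s _ => (add_zero _).symm⟩
    rcases mul_eq_zero.1 hs with h | h
    · exact absurd h (zpow_ne_zero _ (p_cpow_ne_zero s))
    · rw [← hcast, sub_eq_zero] at h
      exact absurd (by exact_mod_cast h.symm) hρ1.ne

end Zeros

end WeakMellin

end

theorem mainTheorem7 (p : ℕ) [Fact p.Prime] (n : ℕ) (hn : 1 ≤ n)
    (f : WeakMellin.SecondDegreeCharacter (Fin n → ℚ_[p])) (hf : f.IsNondegenerate)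
    (α : ℚ_[p]) (hα : WeakMellin.IsDilation f α) :
    -- the weak Mellin transform is well defined at every `s` with `Re s > 0`
    (∀ s : ℂ, 0 < s.re →
      ∃! M : ℂ, WeakMellin.IsWeakMellin (fun x => (f.toFun x : ℂ)) s M) ∧
    -- its zeros there lie on the axis `Re s = n / 2`
    (∀ s : ℂ, 0 < s.re →
      WeakMellin.IsWeakMellin (fun x => (f.toFun x : ℂ)) s 0 → s.re = n / 2) ∧
    -- it is analytic there and has a meromorphic continuation to the whole plane, and all the
    -- zeros of this continuation lie on the axis `Re s = n / 2`
    ∃ ζ : ℂ → ℂ, Meromorphic ζ ∧ AnalyticOnNhd ℂ ζ {s : ℂ | 0 < s.re} ∧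
      (∀ s : ℂ, 0 < s.re → WeakMellin.IsWeakMellin (fun x => (f.toFun x : ℂ)) s (ζ s)) ∧
      ∀ s : ℂ, 0 < meromorphicOrderAt ζ s → s.re = n / 2 := by
  open WeakMellin MeasureTheory in
  obtain ⟨k₀, k₁, C, hk, h1, hmid, hC, hCn⟩ := hα.exists_integral_pBall (hα.ne_zero hn hf) hn
  obtain ⟨N, hNd, hN0, hN⟩ := exists_numerator (p := p) hn hCn
  have hcont := continuous_toFun_coe f
  have hb : ∀ x, ‖(f.toFun x : ℂ)‖ ≤ 1 := fun x => (Circle.norm_coe _).le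
  have h1' : ∀ x ∈ pBall p n k₀, (f.toFun x : ℂ) = 1 := fun x hx => by
    rw [h1 x hx, Circle.coe_one]
  have h0 : ∀ k, k₁ < k → ∫ x in pSphere p n k, (f.toFun x : ℂ) ∂(vecHaar p n) = 0 :=
    fun k hk => by
      rw [← pBall_sdiff_pBall_sub_one, setIntegral_sdiff (measurableSet_pBall _)
        (hcont.continuousOn.integrableOn_compact (isCompact_pBall _)) (pBall_mono (by omega)),
        hC k hk.le, hC (k - 1) (by omega), sub_self]
  have hDne : ∀ s : ℂ, 0 < s.re → 1 - ((p : ℂ) ^ s)⁻¹ ≠ 0 := fun s hs h => by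
    have := norm_inv_p_cpow_lt_one (p := p) hs
    rw [← sub_eq_zero.1 h, norm_one] at this
    exact lt_irrefl _ this
  have hDd : Differentiable ℂ fun s : ℂ => 1 - ((p : ℂ) ^ s)⁻¹ :=
    (differentiable_const _).sub (differentiable_p_cpow.inv p_cpow_ne_zero)
  set D : ℂ → ℂ := fun s => 1 - ((p : ℂ) ^ s)⁻¹ with hD
  have hM : ∀ s : ℂ, 0 < s.re → IsWeakMellin (fun x => (f.toFun x : ℂ)) s ((N * D⁻¹) s) := by
    intro s hs
    have h2 := isWeakMellin_mellinVec hn hcont hb h1' h0 hs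
    rw [mellinVec_lam_kInd hn hcont hb hk h1' hmid hC hs, ← hN s (hDne s hs)] at h2
    exact h2
  have hNan : ∀ s, AnalyticAt ℂ N s := fun s => hNd.analyticAt s
  have hDan : ∀ s, AnalyticAt ℂ D s := fun s => hDd.analyticAt s
  refine ⟨fun s hs => ⟨_, hM s hs, fun M hM' => ?_⟩, fun s hs h => ?_, N * D⁻¹, ?_, ?_, hM, ?_⟩
  · rw [hM'.eq_mellinVec hn, (hM s hs).eq_mellinVec hn]
  · have h2 := (hM s hs).eq_mellinVec hn
    rw [← h.eq_mellinVec hn] at h2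
    exact hN0 s ((mul_eq_zero.1 h2).resolve_right (inv_ne_zero (hDne s hs)))
  · exact fun s => (hNan s).meromorphicAt.mul (hDan s).meromorphicAt.inv
  · exact fun s hs => (hNan s).mul ((hDan s).inv (hDne s hs))
  · intro s hs
    refine hN0 s ?_
    by_contra hne
    -- otherwise `D` would vanish identically, and `-⊤ = ⊤` in `WithTop ℤ`
    have hDtop : meromorphicOrderAt D s ≠ ⊤ := fun htop => by
      have h2 := (meromorphicOrderAt_eq_top_iff.1 htop).frequently
      have h3 := AnalyticOnNhd.eqOn_zero_of_preconnected_of_frequently_eq_zero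
        (fun z _ => hDan z) isPreconnected_univ (Set.mem_univ s) h2 (Set.mem_univ 1)
      exact hDne 1 (by simp) h3
    have hD0 := (hDan s).meromorphicOrderAt_nonneg
    have hN1 : meromorphicOrderAt N s = 0 := by
      rw [(hNan s).meromorphicOrderAt_eq, (hNan s).analyticOrderAt_eq_zero.2 hne]
      rfl
    rw [meromorphicOrderAt_mul (hNan s).meromorphicAt (hDan s).meromorphicAt.inv,
      meromorphicOrderAt_inv, hN1, zero_add] at hs
    lift meromorphicOrderAt D s to ℤ using hDtop with d
    have h4 : 0 ≤ d := by exact_mod_cast hD0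
    have h5 : 0 < -d := by exact_mod_cast hs
    omega
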